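/- Let $N,d\ge 1$, and let $\mathbf{x}_1,\dots,\mathbf{x}_N\in\mathbb{R}^d$ be a dataset (the labels $y_n=\pm1$ are absorbed into the points, i.e. $y_n\mathbf{x}_n$ is written $\mathbf{x}_n$). For Lebesgue-almost every dataset $(\mathbf{x}_1,\dots,\mathbf{x}_N)\in(\mathbb{R}^d)^N$ the following holds. Assume that the dataset is strictly linearly separable, i.e. some $\mathbf{w}_*$ has $\mathbf{w}_*^\top\mathbf{x}_n>0$ for all $n$. Put $$\gamma=\max_{\|\mathbf{w}\|=1}\min_n\mathbf{w}^\top\mathbf{x}_n ,$$ let $\sigma_{\max}$ be the largest singular value of the $d\times N$ matrix with columns $\mathbf{x}_n$, and let $$\hat{\mathbf{w}}=\operatorname*{argmin}_{\mathbf{w}}\|\mathbf{w}\|^2\ \text{ s.t. }\ \mathbf{w}^\top\mathbf{x}_n\ge1\ \text{ for all } n$$ (which exists and is unique). Let $\ell:\mathbb{R}\to\mathbb{R}$ be differentiable with $\beta$-Lipschitz derivative, $\ell>0$, $\ell'<0$, $\lim_{u\to\infty}\ell(u)=\lim_{u\to\infty}\ell'(u)=0$ and $\limsup_{u\to-\infty}\ell'(u)\ne0$,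 and let $-\ell'$ have a tight exponential tail: there are $\mu_+,\mu_-,\bar u>0$ with $$(1-e^{-\mu_-u})e^{-u}\le-\ell'(u)\le(1+e^{-\mu_+u})e^{-u}\qquad\text{for all } u>\bar u .$$ Let $N=KB$ with integers $K,B\ge1$, let $\eta>0$, let $\mathbf{w}(0)\in\mathbb{R}^d$ be arbitrary, and consider SGD $$\mathbf{w}(t+1)=\mathbf{w}(t)-\frac{\eta}{B}\sum_{n\in\mathcal{B}(t)}\ell'(\mathbf{w}(t)^\top\mathbf{x}_n)\,\mathbf{x}_n$$ with minibatches $\mathcal{B}(t)\subset\{1,\dots,N\}$ of $B$ distinct indices, in one of two regimes: 1. (with replacement) the minibatches $\mathcal{B}(t)$, $t\ge0$, are independent random sets, at each $t$ every index is selected with the same probability $B/N$, and $\dfrac{\eta}{B}<\dfrac{2\gamma^2}{\beta\sigma_{\max}^4}$; 2. (without replacement) $\bigcup_{k=0}^{K-1}\mathcal{B}(Ku+k)=\{1,\dots,N\}$ for every $u\ge0$, and $$\frac{\eta}{B}<\min\left[\frac{1}{2K\beta\sigma_{\max}^2},\ \frac{\gamma}{2\beta\sigma_{\max}^3(K+\gamma^{-1}\sigma_{\max})}\right].$$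 Then, almost surely in case 1 and surely in case 2, $$\mathbf{w}(t)=\hat{\mathbf{w}}\log\left(\frac{\eta}{B}\cdot\frac{t}{K}\right)+\boldsymbol{\rho}(t)\quad(t\ge1),\qquad \sup_t\|\boldsymbol{\rho}(t)\|<\infty .$$ Consequently (almost surely, respectively surely) $\mathbf{w}(t)/\|\mathbf{w}(t)\|\to\hat{\mathbf{w}}/\|\hat{\mathbf{w}}\|$ with $$\left\|\frac{\mathbf{w}(t)}{\|\mathbf{w}(t)\|}-\frac{\hat{\mathbf{w}}}{\|\hat{\mathbf{w}}\|}\right\|=O\left(\frac1{\log t}\right),\qquad \sum_{n=1}^N\ell(\mathbf{w}(t)^\top\mathbf{x}_n)=O\left(\frac1t\right).$$ -/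

import Mathlib

open MeasureTheory ProbabilityTheory Filter Topology Asymptotics
open scoped NNReal ENNReal RealInnerProductSpace

noncomputable section

namespace SGDMaxMargin

/-- The space `ℝ^d` of weight vectors and data points, with the Euclidean norm. -/
abbrev Vec (d : ℕ) : Type := EuclideanSpace ℝ (Fin d)

/-- A dataset of `N` points of `ℝ^d`. The labels `±1` are absorbed into the points
(`y_n x_n` is written `x_n`). Lebesgue measure on `(ℝ^d)^N` is `volume` on this type. -/
abbrev Dataset (N d : ℕ) : Type := Fin N → Vec d

variable {N d : ℕ}

/-- Strict linear separability (by a homogeneous linear predictor). -/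
def LinearlySeparable (x : Dataset N d) : Prop :=
  ∃ w : Vec d, ∀ n, 0 < ⟪w, x n⟫

/-- The maximal `L²` margin `γ = max_{‖w‖ = 1} min_n wᵀ x_n`. -/
def maxMargin (x : Dataset N d) : ℝ :=
  ⨆ w : Metric.sphere (0 : Vec d) 1, ⨅ n, ⟪(w : Vec d), x n⟫

/-- The `d × N` matrix whose columns are the data points. -/
def dataMatrix (x : Dataset N d) : Matrix (Fin d) (Fin N) ℝ :=
  Matrix.of fun i n => x n i

/-- The largest singular value of the data matrix, i.e. its operator norm as a map between
Euclidean spaces. -/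
def sigmaMax (x : Dataset N d) : ℝ :=
  ‖LinearMap.toContinuousLinearMap (Matrix.toEuclideanLin (dataMatrix x))‖

/-- `v` satisfies the hard-margin constraints `vᵀ x_n ≥ 1` for all `n`. -/
def MarginFeasible (x : Dataset N d) (v : Vec d) : Prop :=
  ∀ n, 1 ≤ ⟪v, x n⟫

/-- `v` is a minimizer of `‖v‖²` subject to `vᵀ x_n ≥ 1` for all `n` (hard-margin SVM). -/
def IsHardMarginSVM (x : Dataset N d) (v : Vec d) : Prop :=
  MarginFeasible x v ∧ ∀ u, MarginFeasible x u → ‖v‖ ^ 2 ≤ ‖u‖ ^ 2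

/-- Smooth monotone losses: positive, differentiable, with `β`-Lipschitz derivative,
strictly decreasing to zero, with `limsup_{u → -∞} ℓ'(u) ≠ 0`. The `limsup` is taken in the extended
reals because `ℓ'` may tend to `-∞` there. -/
structure IsSmoothMonotoneLoss (ℓ : ℝ → ℝ) (β : ℝ≥0) : Prop where
  pos : ∀ u, 0 < ℓ u
  differentiable : Differentiable ℝ ℓ
  lipschitz_deriv : LipschitzWith β (deriv ℓ)
  deriv_neg : ∀ u, deriv ℓ u < 0
  tendsto_zero : Tendsto ℓ atTop (𝓝 0)
  tendsto_deriv_zero : Tendsto (deriv ℓ) atTop (𝓝 0)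
  limsup_deriv_ne_zero : limsup (fun u => ((deriv ℓ u : ℝ) : EReal)) atBot ≠ 0

/-- `f` has a tight exponential tail. -/
def HasTightExponentialTail (f : ℝ → ℝ) : Prop :=
  ∃ μp > 0, ∃ μm > 0, ∃ ubar > 0, ∀ u : ℝ, ubar < u →
    (1 - Real.exp (-μm * u)) * Real.exp (-u) ≤ f u ∧
      f u ≤ (1 + Real.exp (-μp * u)) * Real.exp (-u)

/-- The training loss `L(w) = ∑_n ℓ(wᵀ x_n)`. -/
def trainingLoss (ℓ : ℝ → ℝ) (x : Dataset N d) (w : Vec d) : ℝ :=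
  ∑ n, ℓ ⟪w, x n⟫

/-- The SGD iterates `w(t+1) = w(t) - (η/B) ∑_{n ∈ batch t} ℓ'(w(t)ᵀ x_n) x_n`, `w(0) = w₀`. -/
def sgd (ℓ : ℝ → ℝ) (x : Dataset N d) (η : ℝ) (B : ℕ) (batch : ℕ → Finset (Fin N))
    (w₀ : Vec d) : ℕ → Vec d
  | 0 => w₀
  | t + 1 =>
      let w := sgd ℓ x η B batch w₀ t
      w - (η / B) • ∑ n ∈ batch t, deriv ℓ ⟪w, x n⟫ • x n

/-- Random sampling with replacement: the minibatches at different iterations are independent, each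
consists of `B` distinct indices, and at each iteration every sample is selected with the
same probability (which is then `B / N`). -/
structure SamplesWithReplacement {Ω : Type*} [MeasurableSpace Ω] (P : Measure Ω) (B : ℕ)
    (batch : ℕ → Ω → Finset (Fin N)) : Prop where
  measurable : ∀ t s, MeasurableSet {ω | batch t ω = s}
  card_eq : ∀ t ω, (batch t ω).card = B
  indep : iIndepFun (m := fun _ => ⊤) batch P
  uniform : ∀ t n, P.real {ω | n ∈ batch t ω} = (B : ℝ) / N

/-- Sampling without replacement: each minibatch consists of `B` distinct indices, and the `K`
minibatches of each epoch cover (hence, if `N = K * B`, partition) the index set. -/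
structure SamplesWithoutReplacement (B K : ℕ) (batch : ℕ → Finset (Fin N)) : Prop where
  card_eq : ∀ t, (batch t).card = B
  epoch : ∀ u, (Finset.range K).biUnion (fun k => batch (K * u + k)) = Finset.univ

/-- The asymptotic behaviour of a sequence of weights `w(t)`:
`w(t) = log((η/B)·t/K) ŵ + ρ(t)` for `t ≥ 1` with `ρ` bounded; the direction of `w(t)` converges to
that of `ŵ` at rate `O(1 / log t)`; and the training loss is `O(1 / t)`. -/
structure ConvergesToSVM (ℓ : ℝ → ℝ) (x : Dataset N d) (what : Vec d) (η : ℝ) (B K : ℕ)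
    (w : ℕ → Vec d) : Prop where
  expansion : ∃ ρ : ℕ → Vec d, (∃ C : ℝ, ∀ t, ‖ρ t‖ ≤ C) ∧
    ∀ t : ℕ, 1 ≤ t → w t = Real.log (η / B * (t / K)) • what + ρ t
  direction : Tendsto (fun t => ‖w t‖⁻¹ • w t) atTop (𝓝 (‖what‖⁻¹ • what))
  direction_rate : (fun t => ‖w t‖⁻¹ • w t - ‖what‖⁻¹ • what)
    =O[atTop] fun t : ℕ => 1 / Real.log t
  loss_rate : (fun t => trainingLoss ℓ x (w t)) =O[atTop] fun t : ℕ => 1 / (t : ℝ)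

end SGDMaxMargin

end

/-! Write `ŵ` for the hard-margin vector. Everything reduces to showing that `w t - log t • ŵ` stays
bounded; `convergesToSVM_of_norm_sub_le` then gives the expansion (the factor `η / (B K)` inside the
logarithm only adds a constant vector), the direction and the loss rate.

Genericity of the dataset is used once, in `ae_exists_isStrictDual`: almost surely `ŵ = ∑ α n • x n`
with `α n > 0` for exactly those `n` on the margin. Consequently `log t • ŵ` moves by about `α n /
t` along each support vector, the rate at which a step of size `exp (-⟪v, x n⟫)` would move it.

The deterministic core is `IsExpDriven.exists_norm_sub_log_smul_le`: if step coefficients are within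
constant factors of `exp (-⟪v, x n⟫)` and square-summable, the residual is bounded. The scalar drift
`(p - δ a) z` of `support_drift_le` is bounded above by a constant minus a multiple of `|z|`, all
over `t`, so `‖residual‖ ^ 2` is a Lyapunov function. A first pass gives growth `O(log t)`; this
makes the non-support points summable, and a second pass on the span of the support vectors gives
boundedness.

Both sampling regimes are brought to this form. Smoothness and the margin inequality `γ ^ 2 ∑ ℓ' ^ 2
≤ ‖∇L‖ ^ 2` yield descent of the loss, per epoch (`exists_epochBounds`) or in expectation per step
(`summable_integral_sum_deriv_sq`). Hence `∑ ℓ' ^ 2` is summable over time and all margins diverge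
into the exponential tail. Without replacement, the iterates at epoch starts are exponentially
driven, because margins barely move within an epoch. With replacement, the sampling noise is an
`L²`-bounded martingale, hence almost surely bounded, and subtracting it leaves an exponentially
driven sequence. -/

namespace SGDMaxMargin

/-! ### Singular value and margin inequalities for the data. -/

section Geometry

variable {N d : ℕ} {x : Dataset N d}

theorem toEuclideanLin_dataMatrix (x : Dataset N d) (c : Fin N → ℝ) :
    Matrix.toEuclideanLin (dataMatrix x) (WithLp.toLp 2 c) = ∑ n, c n • x n := by
  ext i
  simp [Matrix.toEuclideanLin, dataMatrix, Matrix.mulVec, dotProduct, mul_comm]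

theorem sigmaMax_nonneg (x : Dataset N d) : 0 ≤ sigmaMax x := norm_nonneg _

theorem norm_sum_smul_sq_le (x : Dataset N d) (c : Fin N → ℝ) :
    ‖∑ n, c n • x n‖ ^ 2 ≤ sigmaMax x ^ 2 * ∑ n, c n ^ 2 := by
  have h := (LinearMap.toContinuousLinearMap
    (Matrix.toEuclideanLin (dataMatrix x))).le_opNorm (WithLp.toLp 2 c)
  rw [LinearMap.coe_toContinuousLinearMap', toEuclideanLin_dataMatrix] at h
  have h2 : ‖(WithLp.toLp 2 c : EuclideanSpace ℝ (Fin N))‖ ^ 2 = ∑ n, c n ^ 2 := by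
    rw [EuclideanSpace.norm_sq_eq]; simp
  rw [← h2, ← mul_pow]
  exact pow_le_pow_left₀ (norm_nonneg _) h 2

/-- Cauchy–Schwarz applied to `S = ⟪w, ∑ ⟪w, x n⟫ • x n⟫` gives `S ^ 2 ≤ ‖w‖ ^ 2 σ ^ 2 S`; this is
the bound for the transposed matrix. -/
theorem sum_inner_sq_le (x : Dataset N d) (w : Vec d) :
    ∑ n, ⟪w, x n⟫ ^ 2 ≤ sigmaMax x ^ 2 * ‖w‖ ^ 2 := by
  set S := ∑ n, ⟪w, x n⟫ ^ 2 with hS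
  have hS0 : 0 ≤ S := Finset.sum_nonneg fun n _ => sq_nonneg _
  have h1 : S = ⟪w, ∑ n, ⟪w, x n⟫ • x n⟫ := by
    rw [inner_sum, hS]
    refine Finset.sum_congr rfl fun n _ => ?_
    rw [inner_smul_right]; ring
  have h2 := norm_sum_smul_sq_le x fun n => ⟪w, x n⟫
  have h3 : S ^ 2 ≤ ‖w‖ ^ 2 * (sigmaMax x ^ 2 * S) := by
    calc S ^ 2 ≤ (‖w‖ * ‖∑ n, ⟪w, x n⟫ • x n‖) ^ 2 := by
          apply pow_le_pow_left₀ hS0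
          nth_rewrite 1 [h1]
          exact real_inner_le_norm _ _
      _ ≤ _ := by rw [mul_pow]; gcongr
  rcases hS0.eq_or_lt with h | h
  · rw [← h]; positivity
  · nlinarith

theorem iInf_inner_le_norm (n₀ : Fin N) (x : Dataset N d) (w : Metric.sphere (0 : Vec d) 1) :
    ⨅ n, ⟪(w : Vec d), x n⟫ ≤ ‖x n₀‖ := by
  refine (ciInf_le (Set.finite_range _).bddBelow n₀).trans ?_
  refine (real_inner_le_norm _ _).trans ?_
  have : ‖(w : Vec d)‖ = 1 := by simp
  rw [this, one_mul]

theorem maxMargin_pos (hN : 0 < N) (hx : LinearlySeparable x) : 0 < maxMargin x := by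
  obtain ⟨w, hw⟩ := hx
  have : Nonempty (Fin N) := ⟨⟨0, hN⟩⟩
  have hw0 : w ≠ 0 := by
    rintro rfl
    simpa using hw ⟨0, hN⟩
  let u : Metric.sphere (0 : Vec d) 1 := ⟨‖w‖⁻¹ • w, by
    simp [norm_smul, hw0]⟩
  refine lt_of_lt_of_le ?_ (le_ciSup (f := fun w : Metric.sphere (0 : Vec d) 1 =>
    ⨅ n, ⟪(w : Vec d), x n⟫) ⟨‖x ⟨0, hN⟩‖, ?_⟩ u)
  · obtain ⟨n, hn⟩ := exists_eq_ciInf_of_finite (f := fun n => ⟪(u : Vec d), x n⟫)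
    rw [← hn]
    simp only [u, inner_smul_left]
    have := hw n
    have := norm_pos_iff.2 hw0
    simp only [map_inv₀, conj_trivial]
    positivity
  · rintro _ ⟨v, rfl⟩
    exact iInf_inner_le_norm _ x v

/-- Pairing the combination with any unit vector gives at least that vector's margin times `∑ c n`.
Applied to `c = -ℓ'`, this keeps the gradient from being small through cancellation. -/
theorem maxMargin_mul_sum_le (hN : 0 < N) (hx : LinearlySeparable x) (c : Fin N → ℝ)
    (hc : ∀ n, 0 ≤ c n) : maxMargin x * ∑ n, c n ≤ ‖∑ n, c n • x n‖ := by
  obtain ⟨w, hw⟩ := hx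
  have hw0 : w ≠ 0 := by
    rintro rfl
    simpa using hw ⟨0, hN⟩
  have : Nonempty (Metric.sphere (0 : Vec d) 1) := ⟨⟨‖w‖⁻¹ • w, by simp [norm_smul, hw0]⟩⟩
  rcases (Finset.sum_nonneg fun n (_ : n ∈ Finset.univ) => hc n).eq_or_lt with h | h
  · rw [← h]; simp
  · rw [← le_div_iff₀ h]
    refine ciSup_le fun u => ?_
    rw [le_div_iff₀ h]
    have hu : ‖(u : Vec d)‖ = 1 := by simp
    calc (⨅ n, ⟪(u : Vec d), x n⟫) * ∑ n, c n = ∑ n, (⨅ n, ⟪(u : Vec d), x n⟫) * c n := by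
          rw [Finset.mul_sum]
      _ ≤ ∑ n, ⟪(u : Vec d), x n⟫ * c n := by
          refine Finset.sum_le_sum fun n _ => mul_le_mul_of_nonneg_right ?_ (hc n)
          exact ciInf_le (Set.finite_range _).bddBelow n
      _ = ⟪(u : Vec d), ∑ n, c n • x n⟫ := by
          rw [inner_sum]
          exact Finset.sum_congr rfl fun n _ => by rw [inner_smul_right]; ring
      _ ≤ _ := by
          refine (real_inner_le_norm _ _).trans ?_
          rw [hu, one_mul]

theorem maxMargin_sq_mul_sum_sq_le (hN : 0 < N) (hx : LinearlySeparable x) (c : Fin N → ℝ)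
    (hc : ∀ n, 0 ≤ c n) : maxMargin x ^ 2 * ∑ n, c n ^ 2 ≤ ‖∑ n, c n • x n‖ ^ 2 := by
  calc maxMargin x ^ 2 * ∑ n, c n ^ 2 ≤ maxMargin x ^ 2 * (∑ n, c n) ^ 2 := by
        gcongr; exact Finset.sum_sq_le_sq_sum_of_nonneg fun n _ => hc n
    _ = (maxMargin x * ∑ n, c n) ^ 2 := by ring
    _ ≤ _ := by
        refine pow_le_pow_left₀ ?_ (maxMargin_mul_sum_le hN hx c hc) 2
        exact mul_nonneg (maxMargin_pos hN hx).le (Finset.sum_nonneg fun n _ => hc n)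

theorem sigmaMax_pos (hN : 0 < N) (hx : LinearlySeparable x) : 0 < sigmaMax x := by
  refine (sigmaMax_nonneg x).lt_of_ne' fun h => ?_
  have h1 := maxMargin_sq_mul_sum_sq_le hN hx (fun _ => 1) (fun _ => zero_le_one)
  have h2 := norm_sum_smul_sq_le x (fun _ => 1)
  have h3 := maxMargin_pos hN hx
  rw [h] at h2
  have hN' : (0 : ℝ) < N := by exact_mod_cast hN
  have h4 : 0 < maxMargin x ^ 2 * N := by positivity
  simp only [one_pow, Finset.sum_const, Finset.card_univ, Fintype.card_fin, nsmul_eq_mul,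
    mul_one] at h1 h2
  linarith

end Geometry

/-! ### Duality for the hard-margin problem and generic strict complementarity. -/

section HardMargin

variable {N d : ℕ} {x : Dataset N d}

/-- First-order optimality: for small `t` the linear term dominates the quadratic one. -/
theorem nonneg_of_forall_small {a b δ : ℝ} (hδ : 0 < δ)
    (h : ∀ t, 0 < t → t ≤ δ → 0 ≤ t * a + t ^ 2 * b) : 0 ≤ a := by
  by_contra! ha
  have hb : 0 < |b| + 1 := by positivity
  set t := min δ (-a / (2 * (|b| + 1))) with ht
  have ht0 : 0 < t := lt_min hδ (div_pos (neg_pos.2 ha) (by positivity))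
  have h1 := h t ht0 (min_le_left _ _)
  have h2 : t * (2 * (|b| + 1)) ≤ -a := by
    rw [← le_div_iff₀ (by positivity)]; exact min_le_right _ _
  have h3 : b ≤ |b| := le_abs_self b
  have h4 : 0 ≤ a + t * b := by
    by_contra! h5
    nlinarith
  nlinarith

/-- Nonnegative weights expressing `w` as a combination of the data points that satisfy their margin
constraint with equality. -/
structure IsDualCertificate (x : Dataset N d) (w : Vec d) (α : Fin N → ℝ) : Prop where
  nonneg : ∀ n, 0 ≤ α n
  sum_eq : w = ∑ n, α n • x n
  slack : ∀ n, α n = 0 ∨ ⟪w, x n⟫ = 1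

/-- A minimizer of the dual objective `‖∑ α n • x n‖ ^ 2 / 2 - ∑ α n` over `α ≥ 0` satisfies the KKT
conditions, read off by perturbing one coordinate at a time. -/
theorem exists_dualCertificate (hN : 0 < N) (hx : LinearlySeparable x) :
    ∃ w α, MarginFeasible x w ∧ IsDualCertificate x w α := by
  have hγ := maxMargin_pos hN hx
  set γ := maxMargin x
  let F : (Fin N → ℝ) → ℝ := fun α => ‖∑ n, α n • x n‖ ^ 2 / 2 - ∑ n, α n
  have hF : Continuous F := by fun_prop
  -- Beyond this radius `γ ^ 2 s ^ 2 / 2 > s` for `s = ∑ a n`, so the objective is positive while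
  -- its value at `0` is `0`. A minimizer over the compact box is therefore a minimizer over the
  -- whole orthant.
  set R : ℝ := 2 / γ ^ 2 with hR
  have hR0 : 0 < R := by positivity
  obtain ⟨α, hα, hmin⟩ := (isCompact_Icc (a := (0 : Fin N → ℝ)) (b := fun _ => R)).exists_isMinOn
    ⟨0, le_refl _, fun _ => hR0.le⟩ hF.continuousOn
  have hmin' : ∀ a : Fin N → ℝ, (∀ n, 0 ≤ a n) → F α ≤ F a := by
    intro a ha
    by_cases hle : ∀ n, a n ≤ R
    · exact hmin ⟨ha, hle⟩
    · push Not at hle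
      obtain ⟨n, hn⟩ := hle
      have h0 : F α ≤ F 0 := hmin ⟨le_refl _, fun _ => hR0.le⟩
      have hF0 : F 0 = 0 := by simp [F]
      have hs : a n ≤ ∑ n, a n := Finset.single_le_sum (fun m _ => ha m) (Finset.mem_univ n)
      have h1 := maxMargin_mul_sum_le hN hx a ha
      have h2 : (γ * ∑ n, a n) ^ 2 ≤ ‖∑ n, a n • x n‖ ^ 2 :=
        pow_le_pow_left₀ (mul_nonneg hγ.le (hR0.le.trans (hn.le.trans hs))) h1 2
      set s := ∑ n, a n
      have h3 : R < s := hn.trans_le hs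
      have h4 : 2 < s * γ ^ 2 := by rwa [hR, div_lt_iff₀ (by positivity)] at h3
      have h5 : F a = ‖∑ n, a n • x n‖ ^ 2 / 2 - s := rfl
      nlinarith
  set w := ∑ n, α n • x n with hw
  have hpert : ∀ n t, F (α + Pi.single n t) = F α + (t * (⟪w, x n⟫ - 1) +
      t ^ 2 * (‖x n‖ ^ 2 / 2)) := by
    intro n t
    have h1 : ∑ m, (α + Pi.single n t : Fin N → ℝ) m • x m = w + t • x n := by
      simp [add_smul, Finset.sum_add_distrib, hw, Pi.single_apply]
    have h2 : ∑ m, (α + Pi.single n t : Fin N → ℝ) m = ∑ m, α m + t := by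
      simp [Finset.sum_add_distrib]
    simp only [F]
    rw [h1, h2, norm_add_sq_real, inner_smul_right, norm_smul, mul_pow, ← hw, Real.norm_eq_abs,
      sq_abs]
    ring
  have hnonneg : ∀ n t, -α n ≤ t → 0 ≤ t * (⟪w, x n⟫ - 1) + t ^ 2 * (‖x n‖ ^ 2 / 2) := by
    intro n t ht
    have := hmin' (α + Pi.single n t) fun m => by
      by_cases h : m = n
      · subst h; simp; linarith
      · simpa [h] using hα.1 m
    rw [hpert] at this
    linarith
  refine ⟨w, α, fun n => ?_, hα.1, hw, fun n => ?_⟩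
  · have := nonneg_of_forall_small one_pos fun t h0 _ =>
      hnonneg n t ((neg_nonpos.2 (hα.1 n)).trans h0.le)
    linarith
  -- When `α n > 0`, decreasing that coordinate is also allowed, which turns the constraint into an
  -- equality.
  · refine or_iff_not_imp_left.2 fun h => le_antisymm ?_ ?_
    · have h1 : 0 < α n := (hα.1 n).lt_of_ne' h
      have := nonneg_of_forall_small (a := -(⟪w, x n⟫ - 1)) h1 fun t h0 h1 => by
        have := hnonneg n (-t) (neg_le_neg h1)
        rw [neg_sq, neg_mul] at this
        rwa [mul_neg]
      linarith
    · have := nonneg_of_forall_small one_pos fun t h0 _ =>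
        hnonneg n t ((neg_nonpos.2 (hα.1 n)).trans h0.le)
      linarith

theorem IsDualCertificate.norm_sq_eq {w : Vec d} {α : Fin N → ℝ} (h : IsDualCertificate x w α) :
    ‖w‖ ^ 2 = ∑ n, α n := by
  rw [← real_inner_self_eq_norm_sq]
  nth_rewrite 2 [h.sum_eq]
  rw [inner_sum]
  refine Finset.sum_congr rfl fun n _ => ?_
  rw [inner_smul_right]
  rcases h.slack n with h0 | h1
  · simp [h0]
  · simp [h1]

/-- Expanding `w` in the data gives `⟪u, w⟫ ≥ ∑ α n = ‖w‖ ^ 2`. This variational inequality yields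
both optimality and uniqueness. -/
theorem IsDualCertificate.norm_sq_le_inner {w u : Vec d} {α : Fin N → ℝ}
    (h : IsDualCertificate x w α) (hu : MarginFeasible x u) : ‖w‖ ^ 2 ≤ ⟪u, w⟫ := by
  rw [h.norm_sq_eq, h.sum_eq, inner_sum]
  refine Finset.sum_le_sum fun n _ => ?_
  rw [inner_smul_right]
  nlinarith [h.nonneg n, hu n]

theorem IsDualCertificate.isHardMarginSVM {w : Vec d} {α : Fin N → ℝ}
    (h : IsDualCertificate x w α) (hw : MarginFeasible x w) : IsHardMarginSVM x w := by
  refine ⟨hw, fun u hu => ?_⟩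
  have h1 := h.norm_sq_le_inner hu
  have h2 := norm_sub_sq_real u w
  nlinarith [sq_nonneg ‖u - w‖]

theorem IsDualCertificate.eq_of_isHardMarginSVM {w u : Vec d} {α : Fin N → ℝ}
    (h : IsDualCertificate x w α) (hw : MarginFeasible x w) (hu : IsHardMarginSVM x u) :
    u = w := by
  have h1 := h.norm_sq_le_inner hu.1
  have h2 := norm_sub_sq_real u w
  have h3 := hu.2 w hw
  have h4 : ‖u - w‖ ^ 2 ≤ 0 := by linarith
  have h5 : ‖u - w‖ = 0 := by
    apply pow_eq_zero_iff (two_ne_zero) |>.1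
    exact le_antisymm h4 (sq_nonneg _)
  exact sub_eq_zero.1 (norm_eq_zero.1 h5)

theorem existsUnique_isHardMarginSVM (hN : 0 < N) (hx : LinearlySeparable x) :
    ∃! w, IsHardMarginSVM x w := by
  obtain ⟨w, α, hw, h⟩ := exists_dualCertificate hN hx
  exact ⟨w, h.isHardMarginSVM hw, fun u hu => h.eq_of_isHardMarginSVM hw hu⟩

theorem sum_eq_sum_subtype {M : Type*} [AddCommMonoid M] {p : Fin N → Prop} [DecidablePred p]
    (f : Fin N → M) (h : ∀ n, ¬ p n → f n = 0) : ∑ n, f n = ∑ n : {n // p n}, f n := by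
  rw [← Finset.sum_subtype (Finset.univ.filter p) (by simp) f, Finset.sum_filter]
  exact Finset.sum_congr rfl fun n _ => by
    by_cases hn : p n <;> simp [hn, h]

/-- Carathéodory's reduction: subtract a multiple of a linear relation until a coefficient vanishes.
Complementary slackness survives because the support only shrinks. -/
theorem IsDualCertificate.exists_card_lt {w : Vec d} {α : Fin N → ℝ}
    (h : IsDualCertificate x w α)
    (hdep : ¬ LinearIndependent ℝ fun n : {n // α n ≠ 0} => x n) :
    ∃ α', IsDualCertificate x w α' ∧
      (Finset.univ.filter fun n => α' n ≠ 0).card < (Finset.univ.filter fun n => α n ≠ 0).card := by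
  obtain ⟨c, hc, hcα, n₀, hn₀⟩ : ∃ c : Fin N → ℝ, ∑ n, c n • x n = 0 ∧
      (∀ n, α n = 0 → c n = 0) ∧ ∃ n, 0 < c n := by
    obtain ⟨g, hg, i, hi⟩ := Fintype.not_linearIndependent_iff.1 hdep
    have key : ∀ g : {n // α n ≠ 0} → ℝ, ∑ n, g n • x n = 0 → 0 < g i →
        ∃ c : Fin N → ℝ, ∑ n, c n • x n = 0 ∧ (∀ n, α n = 0 → c n = 0) ∧ ∃ n, 0 < c n := by
      intro g hg hi
      refine ⟨fun n => if hn : α n ≠ 0 then g ⟨n, hn⟩ else 0, ?_, fun n hn => by simp [hn],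
        i, by simpa [i.2] using hi⟩
      rw [sum_eq_sum_subtype (p := fun n => α n ≠ 0) _ fun n hn => by simp [hn], ← hg]
      exact Finset.sum_congr rfl fun n _ => by simp [n.2]
    rcases lt_or_gt_of_ne hi with h | h
    · exact key (-g) (by simp [hg]) (by simpa using h)
    · exact key g hg h
  -- The minimal ratio `α m / c m` is the largest multiple of `c` that keeps all coefficients
  -- nonnegative.
  obtain ⟨m, hm, hmin⟩ := (Finset.univ.filter fun n => 0 < c n).exists_min_image
    (fun n => α n / c n) ⟨n₀, by simpa using hn₀⟩
  simp only [Finset.mem_filter, Finset.mem_univ, true_and] at hm hmin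
  set t := α m / c m with ht
  have ht0 : 0 ≤ t := div_nonneg (h.nonneg m) hm.le
  have hαm : α m ≠ 0 := fun h0 => hm.ne' (hcα m h0)
  have hzero : ∀ n, α n = 0 → α n - t * c n = 0 := fun n hn => by simp [hn, hcα n hn]
  refine ⟨fun n => α n - t * c n, ⟨fun n => ?_, ?_, fun n => ?_⟩, Finset.card_lt_card ?_⟩
  · rcases le_or_gt (c n) 0 with hn | hn
    · nlinarith [h.nonneg n, mul_nonneg ht0 (neg_nonneg.2 hn)]
    · have := hmin n hn
      rw [le_div_iff₀ hn] at this
      linarith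
  · simp only [sub_smul, Finset.sum_sub_distrib, mul_smul, ← Finset.smul_sum, hc, smul_zero,
      sub_zero]
    exact h.sum_eq
  · rcases h.slack n with h0 | h1
    · exact Or.inl (hzero n h0)
    · exact Or.inr h1
  · rw [Finset.ssubset_iff_of_subset]
    · refine ⟨m, by simpa using hαm, ?_⟩
      simp [ht, hm.ne']
    · intro n
      simp only [Finset.mem_filter, Finset.mem_univ, true_and]
      exact mt (hzero n)

theorem IsDualCertificate.exists_linearIndependent {w : Vec d} {α : Fin N → ℝ}
    (h : IsDualCertificate x w α) :
    ∃ α', IsDualCertificate x w α' ∧ LinearIndependent ℝ fun n : {n // α' n ≠ 0} => x n := by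
  induction hk : (Finset.univ.filter fun n => α n ≠ 0).card using Nat.strong_induction_on
    generalizing α with
  | _ k ih =>
    by_cases hdep : LinearIndependent ℝ fun n : {n // α n ≠ 0} => x n
    · exact ⟨α, h, hdep⟩
    · obtain ⟨α', h', hlt⟩ := h.exists_card_lt hdep
      exact ih _ (hk ▸ hlt) h' rfl

/-- The minimum-norm vector having inner product one with the data points indexed by `T`, when these
points are linearly independent. -/
noncomputable def supportVec (x : Dataset N d) (T : Finset (Fin N)) : Vec d :=
  ∑ m : T, ((Matrix.gram ℝ fun n : T => x n)⁻¹.mulVec fun _ => 1) m • x m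

theorem supportVec_congr {x y : Dataset N d} {T : Finset (Fin N)} (h : ∀ n ∈ T, x n = y n) :
    supportVec x T = supportVec y T := by
  have : (fun n : T => x n) = fun n : T => y n := funext fun n => h n n.2
  simp only [supportVec, this]
  exact Finset.sum_congr rfl fun n _ => by rw [h n n.2]

theorem measurable_supportVec (T : Finset (Fin N)) :
    Measurable fun x : Dataset N d => supportVec x T := by
  have hgram : Continuous fun x : Dataset N d => Matrix.gram ℝ fun n : T => x n :=
    continuous_matrix fun i j => by simp only [Matrix.gram_apply]; fun_prop
  have hinv : ∀ i j : T, Measurable fun x : Dataset N d =>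
      (Matrix.gram ℝ fun n : T => x n)⁻¹ i j := by
    intro i j
    simp only [Matrix.inv_def, Ring.inverse_eq_inv', Matrix.smul_apply, smul_eq_mul]
    exact hgram.matrix_det.measurable.inv.mul
      (hgram.matrix_adjugate.matrix_elem i j).measurable
  unfold supportVec
  refine Finset.measurable_sum _ fun m _ =>
    Measurable.smul (f := fun x : Dataset N d => ((Matrix.gram ℝ fun n : T => x n)⁻¹.mulVec
      fun _ => 1) m) (g := fun x : Dataset N d => x m) ?_ (measurable_pi_apply _)
  simp only [Matrix.mulVec, dotProduct, mul_one]
  exact Finset.measurable_sum _ fun j _ => hinv m j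

/-- Slackness says that the Gram matrix of the support sends `α` to the all-ones vector, and
independence makes it invertible. So `w` is determined by the support points alone. -/
theorem IsDualCertificate.eq_supportVec {w : Vec d} {α : Fin N → ℝ}
    (h : IsDualCertificate x w α)
    (hli : LinearIndependent ℝ fun n : {n // α n ≠ 0} => x n) :
    w = supportVec x (Finset.univ.filter fun n => α n ≠ 0) := by
  set T := Finset.univ.filter fun n => α n ≠ 0 with hT
  have hli' : LinearIndependent ℝ fun n : T => x n := by
    refine hli.comp (fun n : T => (⟨n, (Finset.mem_filter.1 n.2).2⟩ : {n // α n ≠ 0})) ?_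
    intro a b hab
    exact Subtype.ext (congrArg (fun z : {n // α n ≠ 0} => (z : Fin N)) hab)
  have hw : w = ∑ m : T, α m • x m := by
    rw [h.sum_eq]
    conv_rhs => rw [← Finset.sum_subtype T (fun _ => Iff.rfl) fun m => α m • x m]
    rw [hT, Finset.sum_filter]
    exact Finset.sum_congr rfl fun n _ => by by_cases hn : α n = 0 <;> simp [hn]
  have hα : (Matrix.gram ℝ fun n : T => x n).mulVec (fun m => α m) = fun _ => 1 := by
    ext m
    have hm : α m ≠ 0 := (Finset.mem_filter.1 m.2).2
    rw [← (h.slack m).resolve_left hm, hw, sum_inner]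
    simp only [Matrix.mulVec, dotProduct, Matrix.gram_apply]
    refine Finset.sum_congr rfl fun j _ => ?_
    rw [inner_smul_left, real_inner_comm]
    simp [mul_comm]
  have hdet : IsUnit (Matrix.gram ℝ fun n : T => x n).det :=
    isUnit_iff_ne_zero.2 (Matrix.det_gram_ne_zero_iff_linearIndependent.2 hli')
  rw [hw, supportVec, ← hα, Matrix.mulVec_mulVec, Matrix.nonsing_inv_mul _ hdet,
    Matrix.one_mulVec]

theorem volume_setOf_inner_eq_one (u : Vec d) : volume {v : Vec d | ⟪u, v⟫ = 1} = 0 := by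
  let A : AffineSubspace ℝ (Vec d) :=
    (AffineSubspace.mk' (1 : ℝ) ⊥).comap (innerₛₗ ℝ u).toAffineMap
  have hA : (A : Set (Vec d)) = {v : Vec d | ⟪u, v⟫ = 1} := by
    ext v
    simp [A, AffineSubspace.mem_mk', sub_eq_zero]
  rw [← hA]
  refine Measure.addHaar_affineSubspace _ _ fun h => ?_
  have : (0 : Vec d) ∈ (A : Set (Vec d)) := by rw [h]; trivial
  rw [hA] at this
  simp at this

/-- By Fubini, fix all points but `x n`. The vector `supportVec x T` does not involve `x n`, so
equality confines `x n` to an affine subspace missing `0`, which is null. -/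
theorem ae_inner_supportVec_ne_one (T : Finset (Fin N)) {n : Fin N} (hn : n ∉ T) :
    ∀ᵐ x : Dataset N d, ⟪supportVec x T, x n⟫ ≠ 1 := by
  obtain _ | k := N
  · exact n.elim0
  have hmeas : MeasurableSet {x : Dataset (k + 1) d | ⟪supportVec x T, x n⟫ = 1} :=
    measurableSet_eq_fun ((measurable_supportVec T).inner (measurable_pi_apply n))
      measurable_const
  have hmp := (volume_preserving_piFinSuccAbove (fun _ : Fin (k + 1) => Vec d) n).symm
  rw [ae_iff]
  simp only [ne_eq, not_not]
  rw [← hmp.measure_preimage hmeas.nullMeasurableSet]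
  have hmeas' := hmp.measurable hmeas
  change (volume.prod volume) _ = 0
  rw [Measure.prod_apply_symm hmeas']
  refine lintegral_eq_zero_of_ae_eq_zero (Eventually.of_forall fun y => ?_)
  refine Eq.trans (congrArg _ ?_)
    (volume_setOf_inner_eq_one (supportVec (n.insertNth 0 y : Dataset (k + 1) d) T))
  ext v
  have hcongr : supportVec (n.insertNth v y : Dataset (k + 1) d) T =
      supportVec (n.insertNth 0 y : Dataset (k + 1) d) T := by
    refine supportVec_congr fun m hm => ?_
    obtain ⟨j, rfl⟩ := Fin.exists_succAbove_eq (ne_of_mem_of_not_mem hm hn)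
    simp
  simp [MeasurableEquiv.piFinSuccAbove, Fin.insertNthEquiv, hcongr]

/-- `α` is a dual certificate of the hard-margin vector `w` that is strictly complementary: its support
consists of all support vectors. -/
structure IsStrictDual (x : Dataset N d) (w : Vec d) (α : Fin N → ℝ) : Prop where
  sum_eq : w = ∑ n, α n • x n
  strict : ∀ n, (0 < α n ∧ ⟪w, x n⟫ = 1) ∨ (α n = 0 ∧ 1 < ⟪w, x n⟫)

/-- Discard the finitely many null sets indexed by `T` and `n`. The certificate with independent
support expresses the minimizer as a `supportVec`, so no point outside that support lies on the
margin. -/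
theorem ae_exists_isStrictDual (hN : 0 < N) :
    ∀ᵐ x : Dataset N d, LinearlySeparable x → ∀ w, IsHardMarginSVM x w →
      ∃ α, IsStrictDual x w α := by
  have h : ∀ᵐ x : Dataset N d, ∀ (T : Finset (Fin N)) (n : Fin N), n ∉ T →
      ⟪supportVec x T, x n⟫ ≠ 1 :=
    ae_all_iff.2 fun T => ae_all_iff.2 fun n => by
      by_cases hn : n ∈ T
      · exact Eventually.of_forall fun _ h => absurd hn h
      · filter_upwards [ae_inner_supportVec_ne_one T hn] with x hx _ using hx
  filter_upwards [h] with x hgen hx u hu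
  obtain ⟨w, α₀, hw, h₀⟩ := exists_dualCertificate hN hx
  obtain rfl := h₀.eq_of_isHardMarginSVM hw hu
  obtain ⟨α, hα, hli⟩ := h₀.exists_linearIndependent
  refine ⟨α, hα.sum_eq, fun n => ?_⟩
  by_cases hn : α n = 0
  · refine Or.inr ⟨hn, (hw n).lt_of_ne' ?_⟩
    rw [hα.eq_supportVec hli]
    exact hgen _ n (by simpa using hn)
  · exact Or.inl ⟨(hα.nonneg n).lt_of_ne' hn, (hα.slack n).resolve_left hn⟩

end HardMargin

/-! ### Boundedness of the residual for exponentially driven trajectories. -/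

section LogDynamics

variable {N d : ℕ} {x : Dataset N d}

/-- Lyapunov criterion: between returns below `A`, the total increase is at most `∑ h`. -/
theorem exists_forall_le_of_step {V h : ℕ → ℝ} {A : ℝ} (hh : Summable h) (h0 : ∀ t, 0 ≤ h t)
    (hV : ∀ᶠ t in atTop, V (t + 1) ≤ V t + h t ∨ V (t + 1) ≤ A) : ∃ B, ∀ t, V t ≤ B := by
  obtain ⟨T, hT⟩ := eventually_atTop.1 hV
  have key : ∀ t, T ≤ t → V t ≤ max A (V T) + ∑ s ∈ Finset.range t, h s := by
    intro t ht
    induction t, ht using Nat.le_induction with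
    | base =>
      have := Finset.sum_nonneg fun s (_ : s ∈ Finset.range T) => h0 s
      linarith [le_max_right A (V T)]
    | succ t ht ih =>
      rw [Finset.sum_range_succ]
      rcases hT t ht with h | h
      · linarith
      · have := Finset.sum_nonneg fun s (_ : s ∈ Finset.range t) => h0 s
        linarith [le_max_left A (V T), h0 t]
  have hfin : BddAbove (V '' Set.Iio T) := ((Set.finite_Iio T).image V).bddAbove
  obtain ⟨B, hB⟩ := hfin
  refine ⟨max B (max A (V T) + ∑' s, h s), fun t => ?_⟩
  rcases lt_or_ge t T with ht | ht
  · exact le_max_of_le_left (hB ⟨t, ht, rfl⟩)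
  · refine le_max_of_le_right ((key t ht).trans ?_)
    gcongr
    exact hh.sum_le_tsum _ fun s _ => h0 s

theorem mul_exp_neg_le_one (z : ℝ) : z * Real.exp (-z) ≤ 1 := by
  rw [Real.exp_neg, ← div_eq_mul_inv, div_le_one (Real.exp_pos z)]
  linarith [Real.add_one_le_exp z]

/-- For `z ≥ 0` the push `p z` is at most `C / t`, as `z exp (-z) ≤ 1`, and the term `-δ a z`
dominates. For `z ≤ 0`, `exp (-z) ≥ -z` produces `-c z ^ 2 / t`, and completing the square absorbs
the linear term into `a ^ 2 / c`. -/
theorem support_drift_le {c C a p z δ t : ℝ} (hc : 0 < c) (ha : 0 < a) (ht : 0 < t)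
    (hp1 : c * (Real.exp (-z) / t) ≤ p) (hp2 : p ≤ C * (Real.exp (-z) / t)) (hδ1 : 1 / t ≤ 2 * δ)
    (hδ2 : δ ≤ 1 / t) : (p - δ * a) * z ≤ (C + a ^ 2 / c - a / 2 * |z|) / t := by
  have hCc : c ≤ C := by
    have : 0 < Real.exp (-z) / t := by positivity
    exact le_of_mul_le_mul_right (hp1.trans hp2) this
  have hi : 0 < 1 / t := by positivity
  have hac : 0 < a ^ 2 / c := by positivity
  rw [div_eq_mul_one_div]
  rw [div_eq_mul_one_div (Real.exp (-z)) t] at hp1 hp2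
  set i := 1 / t
  rcases le_total 0 z with hz | hz
  · rw [abs_of_nonneg hz]
    have h1 : p * z ≤ C * i := by
      calc p * z ≤ C * (Real.exp (-z) * i) * z := mul_le_mul_of_nonneg_right hp2 hz
        _ = C * i * (z * Real.exp (-z)) := by ring
        _ ≤ C * i * 1 := by
          refine mul_le_mul_of_nonneg_left (mul_exp_neg_le_one z) ?_
          exact mul_nonneg (hc.le.trans hCc) hi.le
        _ = C * i := mul_one _
    have h2 : i * (a * z) ≤ 2 * δ * (a * z) :=
      mul_le_mul_of_nonneg_right hδ1 (mul_nonneg ha.le hz)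
    nlinarith [mul_pos hac hi]
  · rw [abs_of_nonpos hz]
    have h0 : -z ≤ Real.exp (-z) := by linarith [Real.add_one_le_exp (-z)]
    have h1 : c * (-z * i) ≤ p :=
      le_trans (mul_le_mul_of_nonneg_left (mul_le_mul_of_nonneg_right h0 hi.le) hc.le) hp1
    have h2 : p * z ≤ c * (-z * i) * z := mul_le_mul_of_nonpos_right h1 hz
    have h3 : δ * (a * -z) ≤ i * (a * -z) :=
      mul_le_mul_of_nonneg_right hδ2 (mul_nonneg ha.le (neg_nonneg.2 hz))
    have h4 : 3 / 2 * a * (-z) - c * (-z) ^ 2 ≤ a ^ 2 / c := by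
      rw [le_div_iff₀ hc]
      nlinarith [sq_nonneg (c * (-z) - 3 / 4 * a), sq_nonneg a]
    have h5 : (3 / 2 * a * (-z) - c * (-z) ^ 2) * i ≤ (a ^ 2 / c + C) * i :=
      mul_le_mul_of_nonneg_right (by linarith) hi.le
    linarith

theorem log_succ_sub_log_le (t : ℕ) : Real.log (t + 1 : ℕ) - Real.log t ≤ 1 / t := by
  rcases t.eq_zero_or_pos with rfl | ht
  · simp
  · have ht' : (0 : ℝ) < t := by exact_mod_cast ht
    rw [← Real.log_div (by positivity) (by positivity)]
    refine (Real.log_le_sub_one_of_pos (by positivity)).trans ?_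
    rw [Nat.cast_add_one, div_sub_one ht'.ne']
    simp

theorem one_div_le_two_mul_log_succ_sub_log {t : ℕ} (ht : 1 ≤ t) :
    1 / (t : ℝ) ≤ 2 * (Real.log (t + 1 : ℕ) - Real.log t) := by
  have ht' : (1 : ℝ) ≤ t := by exact_mod_cast ht
  have h : Real.log (t / (t + 1 : ℕ)) ≤ t / (t + 1 : ℕ) - 1 :=
    Real.log_le_sub_one_of_pos (by positivity)
  rw [Real.log_div (by positivity) (by positivity)] at h
  have h2 : (t : ℝ) / (t + 1 : ℕ) - 1 = -(1 / (t + 1)) := by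
    rw [Nat.cast_add_one]; field_simp; ring
  have h3 : 1 / (t : ℝ) ≤ 2 * (1 / (t + 1)) := by
    rw [mul_one_div, div_le_div_iff₀ (by positivity) (by positivity)]
    linarith
  linarith

theorem log_succ_sub_log_nonneg (t : ℕ) : 0 ≤ Real.log (t + 1 : ℕ) - Real.log t := by
  rcases t.eq_zero_or_pos with rfl | ht
  · simp
  · have ht' : (0 : ℝ) < t := by exact_mod_cast ht
    exact sub_nonneg.2 (Real.log_le_log ht' (by push_cast; linarith))

theorem summable_sq_log_succ_sub_log :
    Summable fun t : ℕ => (Real.log (t + 1 : ℕ) - Real.log t) ^ 2 := by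
  refine Summable.of_nonneg_of_le (fun t => sq_nonneg _) (fun t => ?_)
    (Real.summable_one_div_nat_pow.2 one_lt_two)
  rw [← one_div_pow]
  exact pow_le_pow_left₀ (log_succ_sub_log_nonneg t) (log_succ_sub_log_le t) 2

theorem summable_norm_sq_sum_smul (x : Dataset N d) {y : ℕ → Fin N → ℝ}
    (hy : ∀ n, Summable fun t => y t n ^ 2) : Summable fun t => ‖∑ n, y t n • x n‖ ^ 2 :=
  Summable.of_nonneg_of_le (fun _ => sq_nonneg _) (fun t => norm_sum_smul_sq_le x (y t))
    ((summable_sum fun n _ => hy n).mul_left _)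

theorem summable_sub_mul_sq {p δ : ℕ → ℝ} (hp : Summable fun t => p t ^ 2)
    (hδ : Summable fun t => δ t ^ 2) (a : ℝ) : Summable fun t => (p t - δ t * a) ^ 2 := by
  refine Summable.of_nonneg_of_le (fun _ => sq_nonneg _) (fun t => ?_)
    ((hp.mul_left 2).add (hδ.mul_left (2 * a ^ 2)))
  nlinarith [sq_nonneg (p t + δ t * a)]

/-- On the span of the support points the map `s ↦ (α n ⟪s, x n⟫)` is injective, hence bounded below
in finite dimension. This makes the drift coercive there. -/
theorem exists_mul_norm_le_sum_inner (x : Dataset N d) {α : Fin N → ℝ} (hα : ∀ n, 0 ≤ α n) :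
    ∃ κ > 0, ∀ s ∈ Submodule.span ℝ (x '' {n | α n ≠ 0}), κ * ‖s‖ ≤ ∑ n, α n * |⟪s, x n⟫| := by
  set W := Submodule.span ℝ (x '' {n | α n ≠ 0}) with hW
  let f : W →ₗ[ℝ] (Fin N → ℝ) := LinearMap.pi fun n =>
    α n • (innerₛₗ ℝ (x n)).comp W.subtype
  have hf : ∀ s n, f s n = α n * ⟪(s : Vec d), x n⟫ := fun s n => by
    simp [f, real_inner_comm]
  have hker : f.ker = ⊥ := by
    refine LinearMap.ker_eq_bot'.2 fun s hs => ?_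
    have h0 : ∀ u ∈ W, ⟪(s : Vec d), u⟫ = 0 := by
      intro u hu
      induction hu using Submodule.span_induction with
      | mem u hu =>
        obtain ⟨n, hn, rfl⟩ := hu
        have := congrFun hs n
        rw [hf] at this
        exact (mul_eq_zero.1 this).resolve_left hn
      | zero => simp
      | add u v _ _ hu hv => rw [inner_add_right, hu, hv, add_zero]
      | smul a u _ hu => rw [inner_smul_right, hu, mul_zero]
    exact Subtype.ext (inner_self_eq_zero.1 (h0 s s.2))
  obtain ⟨K, hK, hanti⟩ := f.exists_antilipschitzWith hker
  have hK' : (0 : ℝ) < K := hK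
  refine ⟨(K : ℝ)⁻¹, by positivity, fun s hs => ?_⟩
  have h1 := hanti.le_mul_dist ⟨s, hs⟩ 0
  rw [map_zero, dist_zero_right, dist_zero_right] at h1
  rw [inv_mul_le_iff₀ hK']
  refine h1.trans (mul_le_mul_of_nonneg_left ?_ hK'.le)
  have hnn : ∀ n, 0 ≤ α n * |⟪s, x n⟫| := fun n => mul_nonneg (hα n) (abs_nonneg _)
  refine (pi_norm_le_iff_of_nonneg (Finset.sum_nonneg fun n _ => hnn n)).2 fun n => ?_
  rw [hf, Real.norm_eq_abs, abs_mul, abs_of_nonneg (hα n)]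
  exact Finset.single_le_sum (f := fun n => α n * |⟪s, x n⟫|) (fun n _ => hnn n)
    (Finset.mem_univ n)

theorem norm_add_sum_smul_sq (r : Vec d) (y : Fin N → ℝ) :
    ‖r + ∑ n, y n • x n‖ ^ 2 =
      ‖r‖ ^ 2 + 2 * ∑ n, y n * ⟪r, x n⟫ + ‖∑ n, y n • x n‖ ^ 2 := by
  rw [norm_add_sq_real, inner_sum]
  simp only [inner_smul_right]

/-- Trajectories driven by steps comparable with `exp (-⟪v, x n⟫)` along each data point. -/
structure IsExpDriven (x : Dataset N d) (v : ℕ → Vec d) (p : ℕ → Fin N → ℝ) (c C : ℝ) : Prop where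
  step : ∀ t, v (t + 1) = v t + ∑ n, p t n • x n
  bounds : ∀ᶠ t in atTop, ∀ n, c * Real.exp (-⟪v t, x n⟫) ≤ p t n ∧
    p t n ≤ C * Real.exp (-⟪v t, x n⟫)
  summable_sq : ∀ n, Summable fun t => p t n ^ 2

namespace IsExpDriven

variable {w : Vec d} {α : Fin N → ℝ} {v : ℕ → Vec d} {p : ℕ → Fin N → ℝ} {c C : ℝ}

theorem residual_step (h : IsExpDriven x v p c C) (hα : IsStrictDual x w α) (t : ℕ) :
    v (t + 1) - Real.log (t + 1 : ℕ) • w = v t - Real.log t • w +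
      ∑ n, (p t n - (Real.log (t + 1 : ℕ) - Real.log t) * α n) • x n := by
  have : ∑ n, (p t n - (Real.log (t + 1 : ℕ) - Real.log t) * α n) • x n =
      ∑ n, p t n • x n - (Real.log (t + 1 : ℕ) - Real.log t) • w := by
    simp only [sub_smul, mul_smul, Finset.sum_sub_distrib]
    rw [← Finset.smul_sum, ← Finset.smul_sum, ← hα.sum_eq]
  rw [this, h.step, sub_smul]
  abel

theorem exp_neg_inner_eq {t : ℕ} (ht : 1 ≤ t) (u w z : Vec d) :
    Real.exp (-⟪u, z⟫) = Real.exp (-⟪u - Real.log t • w, z⟫) * (t : ℝ) ^ (-⟪w, z⟫) := by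
  have ht' : (0 : ℝ) < t := by exact_mod_cast ht
  rw [Real.rpow_def_of_pos ht', ← Real.exp_add, inner_sub_left, inner_smul_left]
  congr 1
  simp only [conj_trivial]
  ring

/-- A crude first estimate: the drift of the squared residual is `O(1 / t)`, counting only its upper
bound. Non-support points contribute at most `C / t`, since `t ^ (-⟪w, x n⟫) ≤ 1 / t`. -/
theorem exists_norm_sq_le_log (h : IsExpDriven x v p c C) (hc : 0 < c)
    (hα : IsStrictDual x w α) :
    ∃ A K, ∀ t, ‖v t - Real.log t • w‖ ^ 2 ≤ A + K * Real.log t := by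
  set r : ℕ → Vec d := fun t => v t - Real.log t • w with hr
  set K : ℝ := ∑ n, (C + α n ^ 2 / c) with hK
  have hy : ∀ n, Summable fun t : ℕ =>
      (p t n - (Real.log (t + 1 : ℕ) - Real.log t) * α n) ^ 2 := fun n =>
    summable_sub_mul_sq (h.summable_sq n) summable_sq_log_succ_sub_log _
  obtain ⟨B, hB⟩ := exists_forall_le_of_step
    (V := fun t => ‖r t‖ ^ 2 - 4 * K * Real.log t) (A := 0)
    (summable_norm_sq_sum_smul x hy) (fun _ => sq_nonneg _) (by
      filter_upwards [h.bounds, eventually_ge_atTop 1] with t hb ht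
      left
      have ht' : (0 : ℝ) < t := by exact_mod_cast ht
      have hdrift : ∑ n, (p t n - (Real.log (t + 1 : ℕ) - Real.log t) * α n) * ⟪r t, x n⟫ ≤
          K / t := by
        rw [hK, Finset.sum_div]
        refine Finset.sum_le_sum fun n _ => ?_
        obtain ⟨h1, h2⟩ := hb n
        rw [exp_neg_inner_eq ht (v t) w] at h1 h2
        have hC : 0 < C := by
          have := h1.trans h2
          refine hc.trans_le (le_of_mul_le_mul_right this (by positivity))
        rcases hα.strict n with ⟨hpos, h1n⟩ | ⟨h0, h1n⟩
        · rw [h1n, Real.rpow_neg_one, ← div_eq_mul_inv] at h1 h2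
          refine (support_drift_le hc hpos ht' h1 h2 (one_div_le_two_mul_log_succ_sub_log ht)
            (log_succ_sub_log_le t)).trans ?_
          gcongr
          have := abs_nonneg ⟪r t, x n⟫
          nlinarith
        · rw [h0, mul_zero, sub_zero]
          have hle : (t : ℝ) ^ (-⟪w, x n⟫) ≤ 1 / t := by
            rw [one_div, ← Real.rpow_neg_one]
            exact Real.rpow_le_rpow_of_exponent_le (by exact_mod_cast ht) (by linarith)
          have hp0 : 0 ≤ p t n := le_trans (by positivity) h1
          rcases le_total 0 ⟪r t, x n⟫ with hz | hz
          · calc p t n * ⟪r t, x n⟫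
                ≤ C * (Real.exp (-⟪r t, x n⟫) * (t : ℝ) ^ (-⟪w, x n⟫)) * ⟪r t, x n⟫ :=
                  mul_le_mul_of_nonneg_right h2 hz
              _ = C * (t : ℝ) ^ (-⟪w, x n⟫) * (⟪r t, x n⟫ * Real.exp (-⟪r t, x n⟫)) := by ring
              _ ≤ C * (t : ℝ) ^ (-⟪w, x n⟫) * 1 :=
                  mul_le_mul_of_nonneg_left (mul_exp_neg_le_one _) (by positivity)
              _ ≤ C * (1 / t) * 1 := by gcongr
              _ = _ := by ring
          · refine (mul_nonpos_of_nonneg_of_nonpos hp0 hz).trans ?_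
            positivity
      have hs : r (t + 1) = r t + _ := h.residual_step hα t
      have hK0 : 0 ≤ K := by
        refine Finset.sum_nonneg fun n _ => ?_
        have := le_of_mul_le_mul_right ((hb n).1.trans (hb n).2) (Real.exp_pos _)
        have := hc.trans_le this
        positivity
      have h1 := one_div_le_two_mul_log_succ_sub_log ht
      have h2 : K / t ≤ K * (2 * (Real.log (t + 1 : ℕ) - Real.log t)) := by
        rw [div_eq_mul_one_div]; gcongr
      rw [hs, norm_add_sum_smul_sq]
      linarith)
  exact ⟨B, 4 * K, fun t => by have := hB t; simp only [hr] at this; linarith⟩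

/-- The residual is `O(√(log t))`, so it costs at most half of the excess margin `(θ - 1) log t`.
This leaves a bound `C t ^ (-(1 + θ) / 2)` with exponent below `-1`. -/
theorem summable_of_lt (h : IsExpDriven x v p c C) (hc : 0 < c) (hα : IsStrictDual x w α)
    {n : Fin N} (hn : 1 < ⟪w, x n⟫) : Summable fun t => p t n := by
  obtain ⟨A, K, hAK⟩ := h.exists_norm_sq_le_log hc hα
  set θ := ⟪w, x n⟫ with hθ
  have hlog : Tendsto (fun t : ℕ => Real.log t) atTop atTop :=
    Real.tendsto_log_atTop.comp tendsto_natCast_atTop_atTop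
  have hev : ∀ᶠ L : ℝ in atTop, (A + K * L) * ‖x n‖ ^ 2 ≤ ((θ - 1) / 2 * L) ^ 2 := by
    set D := ‖x n‖ ^ 2
    set ε := ((θ - 1) / 2) ^ 2 with hε
    have hε0 : 0 < ε := by
      have : 0 < (θ - 1) / 2 := by linarith
      positivity
    filter_upwards [eventually_ge_atTop (max 1 ((|A| + |K|) * D / ε))] with L hL
    have h1 : 1 ≤ L := (le_max_left _ _).trans hL
    have h2 : (|A| + |K|) * D ≤ L * ε := by
      rw [← div_le_iff₀ hε0]; exact (le_max_right _ _).trans hL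
    have h3 : A + K * L ≤ (|A| + |K|) * L := by
      nlinarith [le_abs_self A, le_abs_self K, abs_nonneg A]
    calc (A + K * L) * D ≤ (|A| + |K|) * L * D :=
          mul_le_mul_of_nonneg_right h3 (sq_nonneg _)
      _ = (|A| + |K|) * D * L := by ring
      _ ≤ L * ε * L := mul_le_mul_of_nonneg_right h2 (by linarith)
      _ = _ := by rw [hε]; ring
  refine Summable.of_norm_bounded_eventually_nat (g := fun t : ℕ => C * (t : ℝ) ^ (-((1 + θ) / 2)))
    ((Real.summable_nat_rpow.2 (by linarith)).mul_left C) ?_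
  filter_upwards [h.bounds, hlog.eventually hev, eventually_ge_atTop 1] with t hb hl ht
  have ht' : (0 : ℝ) < t := by exact_mod_cast ht
  obtain ⟨h1, h2⟩ := hb n
  have hC : 0 < C := hc.trans_le (le_of_mul_le_mul_right (h1.trans h2) (Real.exp_pos _))
  rw [Real.norm_of_nonneg (le_trans (by positivity) h1)]
  refine h2.trans (mul_le_mul_of_nonneg_left ?_ hC.le)
  rw [Real.rpow_def_of_pos ht']
  refine Real.exp_le_exp.2 ?_
  have hL0 : 0 ≤ Real.log t := Real.log_nonneg (by exact_mod_cast ht)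
  have h3 : |⟪v t - Real.log t • w, x n⟫| ≤ (θ - 1) / 2 * Real.log t := by
    refine abs_le_of_sq_le_sq ?_ (mul_nonneg (by linarith) hL0)
    refine le_trans ?_ hl
    rw [← sq_abs]
    refine (pow_le_pow_left₀ (abs_nonneg _) (abs_real_inner_le_norm _ _) 2).trans ?_
    rw [mul_pow]
    exact mul_le_mul_of_nonneg_right (hAK t) (sq_nonneg _)
  have h4 := neg_le_of_abs_le h3
  rw [inner_sub_left, inner_smul_left, conj_trivial, ← hθ] at h4
  linarith

/-- The residual `v t - log t • w` stays bounded. -/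
theorem exists_norm_sub_log_smul_le (h : IsExpDriven x v p c C) (hc : 0 < c)
    (hα : IsStrictDual x w α) : ∃ R, ∀ t : ℕ, ‖v t - Real.log t • w‖ ≤ R := by
  have hα0 : ∀ n, 0 ≤ α n := fun n => by
    rcases hα.strict n with h | h
    · exact h.1.le
    · exact h.1.ge
  set r : ℕ → Vec d := fun t => v t - Real.log t • w with hr
  set δ : ℕ → ℝ := fun t => Real.log (t + 1 : ℕ) - Real.log t with hδ
  -- the part of the residual driven by the support vectors, and the remaining part
  let y : ℕ → Fin N → ℝ := fun t n => if α n = 0 then 0 else p t n - δ t * α n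
  let q : ℕ → Fin N → ℝ := fun t n => if α n = 0 then p t n else 0
  let s : ℕ → Vec d := fun t => ∑ u ∈ Finset.range t, ∑ n, y u n • x n
  have hrs : ∀ t, r t = s t + (r 0 + ∑ u ∈ Finset.range t, ∑ n, q u n • x n) := by
    intro t
    induction t with
    | zero => simp [s]
    | succ t ih =>
      have h1 : r (t + 1) = r t + _ := h.residual_step hα t
      rw [h1, ih]
      simp only [s, Finset.sum_range_succ]
      have : ∑ n, (p t n - (Real.log (t + 1 : ℕ) - Real.log t) * α n) • x n =
          ∑ n, y t n • x n + ∑ n, q t n • x n := by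
        rw [← Finset.sum_add_distrib]
        refine Finset.sum_congr rfl fun n _ => ?_
        by_cases hn : α n = 0 <;> simp [y, q, hn, hδ]
      rw [this]
      abel
  obtain ⟨F, hF⟩ : ∃ F, ∀ t, ‖r t - s t‖ ≤ F := by
    have hq : Summable fun t => ‖∑ n, q t n • x n‖ := by
      refine Summable.of_nonneg_of_le (fun _ => norm_nonneg _)
        (fun t => norm_sum_le _ _) (summable_sum fun n _ => ?_)
      simp only [norm_smul]
      refine Summable.mul_right _ ?_
      rcases hα.strict n with hn | hn
      · simp [q, hn.1.ne']
      · simpa [q, hn.1] using (h.summable_of_lt hc hα hn.2).abs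
    refine ⟨‖r 0‖ + ∑' t, ‖∑ n, q t n • x n‖, fun t => ?_⟩
    rw [hrs t, add_sub_cancel_left]
    refine (norm_add_le _ _).trans ?_
    gcongr
    exact (norm_sum_le _ _).trans (hq.sum_le_tsum _ fun _ _ => norm_nonneg _)
  have hspan : ∀ t, s t ∈ Submodule.span ℝ (x '' {n | α n ≠ 0}) := by
    refine fun t => Submodule.sum_mem _ fun u _ => Submodule.sum_mem _ fun n _ => ?_
    by_cases hn : α n = 0
    · simp [y, hn]
    · exact Submodule.smul_mem _ _ (Submodule.subset_span ⟨n, hn, rfl⟩)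
  obtain ⟨κ, hκ, hκs⟩ := exists_mul_norm_le_sum_inner x hα0
  set D : ℝ := ∑ n, ‖x n‖ with hD
  have hxD : ∀ n, ‖x n‖ ≤ D := fun n =>
    Finset.single_le_sum (f := fun n => ‖x n‖) (fun _ _ => norm_nonneg _) (Finset.mem_univ n)
  -- Replacing `r t` by `s t` in the exponentials costs at most this factor, because they differ by
  -- a bounded vector.
  set E := Real.exp (F * D) with hE
  have hE0 : 0 < E := Real.exp_pos _
  have hF0 : 0 ≤ F := (norm_nonneg _).trans (hF 0)
  set G : ℝ := ∑ n, (C * E + α n ^ 2 / (c / E)) with hG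
  have hysq : ∀ n, Summable fun t : ℕ => y t n ^ 2 := by
    intro n
    by_cases hn : α n = 0
    · simp [y, hn]
    · simp only [y, if_neg hn]
      exact summable_sub_mul_sq (h.summable_sq n) summable_sq_log_succ_sub_log (α n)
  have hsum := summable_norm_sq_sum_smul x hysq
  have hdrift : ∀ᶠ t : ℕ in atTop, ∑ n, y t n * ⟪s t, x n⟫ ≤ (G - κ / 2 * ‖s t‖) / t ∧ 0 ≤ G := by
    filter_upwards [h.bounds, eventually_ge_atTop 1] with t hb ht
    have ht' : (0 : ℝ) < t := by exact_mod_cast ht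
    have hC : ∀ n : Fin N, 0 < C := fun n =>
      hc.trans_le (le_of_mul_le_mul_right ((hb n).1.trans (hb n).2) (Real.exp_pos _))
    have hterm : ∀ n, y t n * ⟪s t, x n⟫ ≤
        (C * E + α n ^ 2 / (c / E) - α n / 2 * |⟪s t, x n⟫|) / t := by
      intro n
      have := hC n
      rcases hα.strict n with ⟨hpos, h1n⟩ | ⟨h0, h1n⟩
      · have hyn : y t n = p t n - δ t * α n := by simp [y, hpos.ne']
        obtain ⟨h1, h2⟩ := hb n
        rw [exp_neg_inner_eq ht (v t) w, h1n, Real.rpow_neg_one, ← div_eq_mul_inv] at h1 h2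
        have hdiff : |⟪r t - s t, x n⟫| ≤ F * D :=
          (abs_real_inner_le_norm _ _).trans
            (mul_le_mul (hF t) (hxD n) (norm_nonneg _) hF0)
        rw [inner_sub_left, abs_le] at hdiff
        have hup : Real.exp (-⟪r t, x n⟫) ≤ E * Real.exp (-⟪s t, x n⟫) := by
          rw [hE, ← Real.exp_add]; exact Real.exp_le_exp.2 (by linarith)
        have hlo : Real.exp (-⟪s t, x n⟫) ≤ E * Real.exp (-⟪r t, x n⟫) := by
          rw [hE, ← Real.exp_add]; exact Real.exp_le_exp.2 (by linarith)
        rw [hyn]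
        refine support_drift_le (by positivity) hpos ht' (le_trans ?_ h1) (h2.trans ?_)
          (one_div_le_two_mul_log_succ_sub_log ht) (log_succ_sub_log_le t)
        · calc c / E * (Real.exp (-⟪s t, x n⟫) / t)
              ≤ c / E * (E * Real.exp (-⟪r t, x n⟫) / t) := by gcongr
            _ = c * (Real.exp (-⟪r t, x n⟫) / t) := by field_simp
        · calc C * (Real.exp (-⟪r t, x n⟫) / t)
              ≤ C * (E * Real.exp (-⟪s t, x n⟫) / t) := by gcongr
            _ = C * E * (Real.exp (-⟪s t, x n⟫) / t) := by ring
      · simp only [y, h0, if_true, zero_mul, zero_div, sub_zero]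
        positivity
    refine ⟨(Finset.sum_le_sum fun n _ => hterm n).trans ?_, Finset.sum_nonneg fun n _ => ?_⟩
    · rw [← Finset.sum_div]
      gcongr
      rw [Finset.sum_sub_distrib]
      have h1 := hκs (s t) (hspan t)
      have h2 : ∑ n, α n / 2 * |⟪s t, x n⟫| = (∑ n, α n * |⟪s t, x n⟫|) / 2 := by
        rw [Finset.sum_div]; exact Finset.sum_congr rfl fun n _ => by ring
      rw [h2]
      linarith
    · have := hC n
      positivity
  -- Outside the ball of radius `2 G / κ` the drift is nonpositive and only the summable squared
  -- step remains. Inside it, one step cannot exceed the stated level `A`.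
  obtain ⟨B, hB⟩ := exists_forall_le_of_step (V := fun t => ‖s t‖ ^ 2)
    (A := (2 * G / κ) ^ 2 + 2 * G + ∑' t, ‖∑ n, y t n • x n‖ ^ 2) hsum (fun _ => sq_nonneg _) (by
      filter_upwards [hdrift, eventually_ge_atTop 1] with t ⟨hd, hG0⟩ ht
      have ht' : (1 : ℝ) ≤ t := by exact_mod_cast ht
      have hs : s (t + 1) = s t + ∑ n, y t n • x n := Finset.sum_range_succ _ _
      rw [hs, norm_add_sum_smul_sq]
      rcases le_total (2 * G / κ) ‖s t‖ with hl | hl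
      · left
        rw [div_le_iff₀ hκ] at hl
        have : (G - κ / 2 * ‖s t‖) / t ≤ 0 :=
          div_nonpos_of_nonpos_of_nonneg (by linarith) (by linarith)
        linarith
      · right
        have h1 : ‖s t‖ ^ 2 ≤ (2 * G / κ) ^ 2 := pow_le_pow_left₀ (norm_nonneg _) hl 2
        have h2 : (G - κ / 2 * ‖s t‖) / t ≤ G := by
          rw [div_le_iff₀ (by linarith)]
          nlinarith [mul_nonneg hκ.le (norm_nonneg (s t))]
        have h3 := hsum.le_tsum t fun _ _ => sq_nonneg _
        linarith)
  refine ⟨F + (B + 1), fun t => ?_⟩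
  have h1 : ‖r t‖ ≤ ‖r t - s t‖ + ‖s t‖ := norm_le_norm_sub_add _ _
  have h2 : ‖s t‖ ≤ B + 1 := by nlinarith [hB t, sq_nonneg (‖s t‖ - 1)]
  linarith [hF t]

end IsExpDriven

end LogDynamics

/-! ### Consequences of smoothness and of the tail, and the passage from a bounded residual to the
conclusions. -/

section Loss

variable {N d : ℕ} {x : Dataset N d} {ℓ : ℝ → ℝ} {β : ℝ≥0}

namespace IsSmoothMonotoneLoss

theorem beta_pos (h : IsSmoothMonotoneLoss ℓ β) : 0 < (β : ℝ) := by
  by_contra! hβ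
  have hβ0 : (β : ℝ) = 0 := le_antisymm hβ β.2
  have hconst : ∀ u, deriv ℓ u = deriv ℓ 0 := fun u => by
    have := h.lipschitz_deriv.dist_le_mul u 0
    rw [hβ0, zero_mul] at this
    exact dist_le_zero.1 this
  have h1 : Tendsto (deriv ℓ) atTop (𝓝 (deriv ℓ 0)) :=
    tendsto_const_nhds.congr fun u => (hconst u).symm
  exact (h.deriv_neg 0).ne (tendsto_nhds_unique h1 h.tendsto_deriv_zero)

theorem abs_deriv_sub_le (h : IsSmoothMonotoneLoss ℓ β) (u v : ℝ) :
    |deriv ℓ u - deriv ℓ v| ≤ β * |u - v| :=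
  h.lipschitz_deriv.dist_le_mul u v

/-- The function `β / 2 * s ^ 2 - ℓ s` has monotone derivative, so it is convex and lies above its
tangents. -/
theorem le_quadratic (h : IsSmoothMonotoneLoss ℓ β) (u v : ℝ) :
    ℓ v ≤ ℓ u + deriv ℓ u * (v - u) + β / 2 * (v - u) ^ 2 := by
  let f : ℝ → ℝ := fun s => β / 2 * s ^ 2 - ℓ s
  have hd : ∀ s, HasDerivAt f (β * s - deriv ℓ s) s := fun s => by
    have h1 := ((hasDerivAt_pow 2 s).const_mul ((β : ℝ) / 2)).sub (h.differentiable s).hasDerivAt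
    exact HasDerivAt.congr_deriv (f := f) h1 (by push_cast; ring)
  have hder : deriv f = fun s => β * s - deriv ℓ s := funext fun s => (hd s).deriv
  have hconv : ConvexOn ℝ Set.univ f := by
    refine MonotoneOn.convexOn_of_deriv convex_univ
      (fun s _ => (hd s).continuousAt.continuousWithinAt)
      (fun s _ => (hd s).differentiableAt.differentiableWithinAt) ?_
    rw [hder]
    intro a _ b _ hab
    have h1 := (abs_le.1 (h.abs_deriv_sub_le a b)).1
    rw [abs_of_nonpos (sub_nonpos.2 hab)] at h1
    simp only
    linarith
  have htan : f u + (β * u - deriv ℓ u) * (v - u) ≤ f v := by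
    rcases lt_trichotomy u v with huv | rfl | huv
    · have := hconv.deriv_le_slope (Set.mem_univ u) (Set.mem_univ v) huv (hd u).differentiableAt
      rw [(hd u).deriv, slope_def_field, le_div_iff₀ (sub_pos.2 huv)] at this
      linarith
    · simp
    · have := hconv.slope_le_deriv (Set.mem_univ v) (Set.mem_univ u) huv (hd u).differentiableAt
      rw [(hd u).deriv, slope_def_field, div_le_iff₀ (sub_pos.2 huv)] at this
      linarith
  simp only [f] at htan
  nlinarith

/-- The `limsup` condition handles a neighbourhood of `-∞`, and compactness the remaining interval.
Small derivatives therefore force large arguments. -/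
theorem exists_le_neg_deriv (h : IsSmoothMonotoneLoss ℓ β) (M : ℝ) :
    ∃ c > 0, ∀ u ≤ M, c ≤ -deriv ℓ u := by
  have hle : limsup (fun u => ((deriv ℓ u : ℝ) : EReal)) atBot ≤ 0 :=
    limsup_le_of_le (by isBoundedDefault)
      (Eventually.of_forall fun u => by exact_mod_cast (h.deriv_neg u).le)
  obtain ⟨b, hb1, hb2⟩ := EReal.lt_iff_exists_real_btwn.1
    (lt_of_le_of_ne hle h.limsup_deriv_ne_zero)
  obtain ⟨A, hA⟩ := eventually_atBot.1 (eventually_lt_of_limsup_lt hb1)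
  have hb0 : b < 0 := by exact_mod_cast hb2
  obtain ⟨m, hm, hmax⟩ := (isCompact_Icc (a := min A M) (b := M)).exists_isMaxOn
    ⟨M, min_le_right _ _, le_rfl⟩ h.lipschitz_deriv.continuous.continuousOn
  refine ⟨min (-b) (-deriv ℓ m), lt_min (neg_pos.2 hb0) (neg_pos.2 (h.deriv_neg m)),
    fun u hu => ?_⟩
  rcases le_total u (min A M) with huA | huA
  · refine (min_le_left _ _).trans (neg_le_neg ?_)
    have : ((deriv ℓ u : ℝ) : EReal) < b := hA u (huA.trans (min_le_left _ _))
    exact le_of_lt (by exact_mod_cast this)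
  · exact (min_le_right _ _).trans (neg_le_neg (hmax ⟨huA, hu⟩))

theorem tendsto_atTop_of_summable_sq (h : IsSmoothMonotoneLoss ℓ β) {u : ℕ → ℝ}
    (hu : Summable fun t => deriv ℓ (u t) ^ 2) : Tendsto u atTop atTop := by
  refine tendsto_atTop.2 fun M => ?_
  obtain ⟨c, hc, hcM⟩ := h.exists_le_neg_deriv M
  filter_upwards [hu.tendsto_atTop_zero.eventually_lt_const (pow_pos hc 2)] with t ht
  by_contra! hlt
  have := hcM _ hlt.le
  nlinarith

theorem exists_tail_bounds (h : HasTightExponentialTail fun u => -deriv ℓ u) :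
    ∃ U : ℝ, ∀ u, U < u → 1 / 2 * Real.exp (-u) ≤ -deriv ℓ u ∧
      -deriv ℓ u ≤ 2 * Real.exp (-u) := by
  obtain ⟨μp, hp, μm, hm, U, hU, hb⟩ := h
  refine ⟨max U (1 / μm), fun u hu => ?_⟩
  obtain ⟨h1, h2⟩ := hb u ((le_max_left _ _).trans_lt hu)
  have hu0 : 0 < u := hU.trans ((le_max_left _ _).trans_lt hu)
  have h3 : Real.exp (-μp * u) ≤ 1 := Real.exp_le_one_iff.2 (by nlinarith)
  have h4 : Real.exp (-μm * u) ≤ 1 / 2 := by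
    have h5 : 1 < u * μm := by
      rw [← div_lt_iff₀ hm]; exact (le_max_right _ _).trans_lt hu
    have h6 : 2 ≤ Real.exp (u * μm) := by linarith [Real.add_one_le_exp (u * μm)]
    rw [neg_mul, mul_comm, Real.exp_neg, one_div]
    exact inv_anti₀ two_pos h6
  have := Real.exp_pos (-u)
  exact ⟨by nlinarith, by nlinarith⟩

/-- On the tail `ℓ s - 2 exp (-s)` is nondecreasing and tends to `0`, hence is nonpositive. -/
theorem le_two_mul_exp (h : IsSmoothMonotoneLoss ℓ β) {U : ℝ}
    (hU : ∀ u, U < u → -deriv ℓ u ≤ 2 * Real.exp (-u)) {u : ℝ} (hu : U < u) :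
    ℓ u ≤ 2 * Real.exp (-u) := by
  let f : ℝ → ℝ := fun s => ℓ s - 2 * Real.exp (-s)
  have hd : ∀ s, HasDerivAt f (deriv ℓ s + 2 * Real.exp (-s)) s := fun s => by
    have h1 := (h.differentiable s).hasDerivAt.sub
      ((hasDerivAt_neg s).exp.const_mul 2)
    exact HasDerivAt.congr_deriv (f := f) h1 (by ring)
  have hmono : MonotoneOn f (Set.Ioi U) := by
    refine monotoneOn_of_deriv_nonneg (convex_Ioi U)
      (fun s _ => (hd s).continuousAt.continuousWithinAt)
      (fun s _ => (hd s).differentiableAt.differentiableWithinAt) fun s hs => ?_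
    rw [interior_Ioi] at hs
    rw [(hd s).deriv]
    linarith [hU s hs]
  have hlim : Tendsto f atTop (𝓝 0) := by
    have := h.tendsto_zero.sub (Real.tendsto_exp_neg_atTop_nhds_zero.const_mul 2)
    simpa using this
  have : f u ≤ 0 := ge_of_tendsto hlim <| by
    filter_upwards [eventually_ge_atTop u] with s hs
    exact hmono hu (hu.trans_le hs) hs
  simp only [f] at this
  linarith

theorem trainingLoss_add_le (h : IsSmoothMonotoneLoss ℓ β) (x : Dataset N d) (w Δ : Vec d) :
    trainingLoss ℓ x (w + Δ) ≤ trainingLoss ℓ x w + ⟪Δ, ∑ n, deriv ℓ ⟪w, x n⟫ • x n⟫ +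
      β / 2 * (sigmaMax x ^ 2 * ‖Δ‖ ^ 2) := by
  calc trainingLoss ℓ x (w + Δ)
      ≤ ∑ n, (ℓ ⟪w, x n⟫ + deriv ℓ ⟪w, x n⟫ * ⟪Δ, x n⟫ + β / 2 * ⟪Δ, x n⟫ ^ 2) := by
        refine Finset.sum_le_sum fun n _ => ?_
        have := h.le_quadratic ⟪w, x n⟫ ⟪w + Δ, x n⟫
        rw [inner_add_left, add_sub_cancel_left] at this
        rw [inner_add_left]
        exact this
    _ = trainingLoss ℓ x w + ⟪Δ, ∑ n, deriv ℓ ⟪w, x n⟫ • x n⟫ +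
          β / 2 * ∑ n, ⟪Δ, x n⟫ ^ 2 := by
        simp only [Finset.sum_add_distrib, inner_sum, inner_smul_right, Finset.mul_sum,
          trainingLoss]
    _ ≤ _ := by
        gcongr
        exact sum_inner_sq_le x Δ

theorem trainingLoss_nonneg (h : IsSmoothMonotoneLoss ℓ β) (x : Dataset N d) (w : Vec d) :
    0 ≤ trainingLoss ℓ x w :=
  Finset.sum_nonneg fun _ _ => (h.pos _).le

end IsSmoothMonotoneLoss

theorem sgd_succ (ℓ : ℝ → ℝ) (x : Dataset N d) (η : ℝ) (B : ℕ) (batch : ℕ → Finset (Fin N))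
    (w₀ : Vec d) (t : ℕ) :
    sgd ℓ x η B batch w₀ (t + 1) = sgd ℓ x η B batch w₀ t +
      (η / B) • ∑ n ∈ batch t, (-deriv ℓ ⟪sgd ℓ x η B batch w₀ t, x n⟫) • x n := by
  rw [sgd]
  simp only [neg_smul, Finset.sum_neg_distrib, smul_neg, sub_eq_add_neg]

theorem norm_normalize_sub_le {E : Type*} [NormedAddCommGroup E] [NormedSpace ℝ E] (a : E) {b : E}
    (hb : b ≠ 0) : ‖‖a‖⁻¹ • a - ‖b‖⁻¹ • b‖ ≤ 2 * ‖a - b‖ / ‖b‖ := by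
  have hb' : 0 < ‖b‖ := norm_pos_iff.2 hb
  have h1 : ‖a‖⁻¹ • a - ‖b‖⁻¹ • b = (‖a‖⁻¹ - ‖b‖⁻¹) • a + ‖b‖⁻¹ • (a - b) := by
    rw [sub_smul, smul_sub]; abel
  have h2 : ‖(‖a‖⁻¹ - ‖b‖⁻¹) • a‖ ≤ ‖a - b‖ / ‖b‖ := by
    rw [norm_smul]
    rcases eq_or_ne a 0 with rfl | ha
    · simpa using div_nonneg hb'.le hb'.le
    · have ha' : 0 < ‖a‖ := norm_pos_iff.2 ha
      have : ‖‖a‖⁻¹ - ‖b‖⁻¹‖ * ‖a‖ = |‖b‖ - ‖a‖| / ‖b‖ := by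
        rw [inv_sub_inv ha'.ne' hb'.ne', Real.norm_eq_abs, abs_div, abs_of_pos (mul_pos ha' hb')]
        field_simp
      rw [this, norm_sub_rev]
      gcongr
      exact abs_norm_sub_norm_le b a
  have h3 : ‖‖b‖⁻¹ • (a - b)‖ = ‖a - b‖ / ‖b‖ := by
    rw [norm_smul, norm_inv, norm_norm, inv_mul_eq_div]
  rw [h1]
  refine (norm_add_le _ _).trans ?_
  rw [h3]
  calc _ ≤ ‖a - b‖ / ‖b‖ + ‖a - b‖ / ‖b‖ := by gcongr
    _ = _ := by ring

theorem convergesToSVM_of_norm_sub_le (hN : 0 < N) (h : IsSmoothMonotoneLoss ℓ β)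
    (htail : HasTightExponentialTail fun u => -deriv ℓ u) {what : Vec d}
    (hfeas : MarginFeasible x what) {η : ℝ} (hη : 0 < η) {B K : ℕ} (hB : 0 < B) (hK : 0 < K)
    {w : ℕ → Vec d} {R : ℝ} (hR : ∀ t : ℕ, ‖w t - Real.log t • what‖ ≤ R) :
    ConvergesToSVM ℓ x what η B K w := by
  have hwhat : what ≠ 0 := by
    rintro rfl
    have := hfeas ⟨0, hN⟩
    simp only [inner_zero_left] at this
    linarith
  have hw0 : 0 < ‖what‖ := norm_pos_iff.2 hwhat
  have hR0 : 0 ≤ R := (norm_nonneg _).trans (hR 0)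
  have hlog : Tendsto (fun t : ℕ => Real.log t) atTop atTop :=
    Real.tendsto_log_atTop.comp tendsto_natCast_atTop_atTop
  have hdir : (fun t => ‖w t‖⁻¹ • w t - ‖what‖⁻¹ • what) =O[atTop]
      fun t : ℕ => 1 / Real.log t := by
    refine IsBigO.of_bound (2 * R / ‖what‖) ?_
    filter_upwards [hlog.eventually_gt_atTop 0] with t ht
    have h1 := norm_normalize_sub_le (w t) (smul_ne_zero ht.ne' hwhat)
    have h2 : ‖Real.log t • what‖⁻¹ • Real.log t • what = ‖what‖⁻¹ • what := by
      rw [norm_smul, smul_smul, Real.norm_of_nonneg ht.le]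
      congr 1
      field_simp
    rw [h2, norm_smul, Real.norm_of_nonneg ht.le] at h1
    rw [Real.norm_of_nonneg (by positivity)]
    calc _ ≤ _ := h1
      _ ≤ 2 * R / (Real.log t * ‖what‖) := by gcongr; exact hR t
      _ = _ := by field_simp
  refine ⟨?_, ?_, hdir, ?_⟩
  · set a := η / B / K with ha
    have ha0 : 0 < a := by positivity
    -- The expansion is only claimed for `t ≥ 1`, so the value at `0` is free. Elsewhere the two
    -- logarithms differ by the constant `log a`.
    refine ⟨fun t => if t = 0 then 0 else w t - Real.log (η / B * (t / K)) • what,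
      ⟨R + |Real.log a| * ‖what‖, fun t => ?_⟩, fun t ht => ?_⟩
    · by_cases ht : t = 0
      · simp only [ht, if_true, norm_zero]; positivity
      · have ht' : (0 : ℝ) < t := by exact_mod_cast Nat.pos_of_ne_zero ht
        have h1 : η / B * (t / K) = a * t := by rw [ha]; ring
        simp only [ht, if_false]
        rw [h1, Real.log_mul ha0.ne' ht'.ne', add_smul, sub_add_eq_sub_sub_swap]
        refine (norm_sub_le _ _).trans (add_le_add (hR t) ?_)
        rw [norm_smul, Real.norm_eq_abs]
    · have : t ≠ 0 := by omega
      simp [this]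
  · have h0 : Tendsto (fun t : ℕ => 1 / Real.log t) atTop (𝓝 0) := by
      simp only [one_div]
      exact tendsto_inv_atTop_zero.comp hlog
    exact tendsto_sub_nhds_zero_iff.1 (hdir.trans_tendsto h0)
  · obtain ⟨U, hU⟩ := IsSmoothMonotoneLoss.exists_tail_bounds htail
    refine IsBigO.of_bound (∑ n, 2 * Real.exp (R * ‖x n‖)) ?_
    have hmargin : ∀ n, ∀ t : ℕ, 1 ≤ t → Real.log t - R * ‖x n‖ ≤ ⟪w t, x n⟫ := by
      intro n t ht
      have h1 := abs_real_inner_le_norm (w t - Real.log t • what) (x n)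
      have h2 := (abs_le.1 (h1.trans (mul_le_mul_of_nonneg_right (hR t) (norm_nonneg _)))).1
      rw [inner_sub_left, inner_smul_left, conj_trivial] at h2
      have h3 := hfeas n
      have h4 : 0 ≤ Real.log t := Real.log_nonneg (by exact_mod_cast ht)
      nlinarith
    have hlarge : ∀ᶠ t : ℕ in atTop, ∀ n, U < ⟪w t, x n⟫ := by
      refine eventually_all.2 fun n => ?_
      filter_upwards [hlog.eventually_gt_atTop (U + R * ‖x n‖), eventually_ge_atTop 1] with t h1 h2
      linarith [hmargin n t h2]
    filter_upwards [hlarge, eventually_ge_atTop 1] with t hl ht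
    have ht' : (0 : ℝ) < t := by exact_mod_cast ht
    rw [Real.norm_of_nonneg (h.trainingLoss_nonneg x _), Real.norm_of_nonneg (by positivity),
      Finset.sum_mul]
    refine Finset.sum_le_sum fun n _ => ?_
    refine (h.le_two_mul_exp (fun u hu => (hU u hu).2) (hl n)).trans ?_
    rw [mul_assoc]
    refine mul_le_mul_of_nonneg_left ?_ two_pos.le
    have h1 : (1 : ℝ) / t = Real.exp (-Real.log t) := by
      rw [Real.exp_neg, Real.exp_log ht', one_div]
    rw [h1, ← Real.exp_add]
    exact Real.exp_le_exp.2 (by linarith [hmargin n t ht])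

end Loss

/-! ### Sampling without replacement: descent over an epoch. -/

section WithoutReplacement

variable {N d : ℕ} {x : Dataset N d} {ℓ : ℝ → ℝ} {β : ℝ≥0}

/-- Double counting: the `K` batches have total size `K B = N` and hit each index at least once,
hence exactly once. -/
theorem existsUnique_mem_of_biUnion_eq_univ {B K : ℕ} (hNKB : N = K * B) {b : ℕ → Finset (Fin N)}
    (hcard : ∀ k, (b k).card = B) (hcover : (Finset.range K).biUnion b = Finset.univ) (n : Fin N) :
    ∃ m < K, ∀ k < K, n ∈ b k ↔ k = m := by
  have h1 : ∀ n, 1 ≤ ((Finset.range K).filter fun k => n ∈ b k).card := fun n => by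
    have : n ∈ (Finset.range K).biUnion b := by rw [hcover]; exact Finset.mem_univ n
    obtain ⟨k, hk, hn⟩ := Finset.mem_biUnion.1 this
    exact Finset.card_pos.2 ⟨k, Finset.mem_filter.2 ⟨hk, hn⟩⟩
  have h2 : ∑ n, ((Finset.range K).filter fun k => n ∈ b k).card = ∑ _n : Fin N, 1 := by
    have : ∑ n, ((Finset.range K).filter fun k => n ∈ b k).card =
        ∑ k ∈ Finset.range K, (b k).card := by
      simp only [Finset.card_filter]
      rw [Finset.sum_comm]
      simp
    rw [this]
    simp [hcard, hNKB]
  have h3 := (Finset.sum_eq_sum_iff_of_le fun n _ => h1 n).1 h2.symm n (Finset.mem_univ n)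
  obtain ⟨m, hm⟩ := Finset.card_eq_one.1 h3.symm
  have hmem : ∀ k, (k < K ∧ n ∈ b k) ↔ k = m := fun k => by
    rw [← Finset.mem_singleton, ← hm, Finset.mem_filter, Finset.mem_range]
  exact ⟨m, ((hmem m).2 rfl).1, fun k hk => by simpa [hk] using hmem k⟩

/-- The effect of one pass over the data in minibatches. -/
structure EpochBounds (ℓ : ℝ → ℝ) (x : Dataset N d) (a : ℝ) (K : ℕ) (w : ℕ → Vec d) (c : ℝ)
    (V : Fin N → ℝ) : Prop where
  end_eq : w K = w 0 + a • ∑ n, V n • x n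
  eq_neg_deriv : ∀ n, ∃ k < K, V n = -deriv ℓ ⟪w k, x n⟫
  sum_sq_le : ∑ n, V n ^ 2 ≤ 4 * ∑ n, deriv ℓ ⟪w 0, x n⟫ ^ 2
  norm_sub_sq_le : ∀ k ≤ K,
    ‖w k - w 0‖ ^ 2 ≤ 4 * a ^ 2 * sigmaMax x ^ 2 * ∑ n, deriv ℓ ⟪w 0, x n⟫ ^ 2
  loss_le : trainingLoss ℓ x (w K) ≤
    trainingLoss ℓ x (w 0) - c * ∑ n, deriv ℓ ⟪w 0, x n⟫ ^ 2

/-- One epoch is a full gradient step from `w 0` with error `e`, caused by evaluating derivatives at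
moved iterates. The margin inequality bounds `‖e‖` by a multiple of `‖G‖`, and the step-size
conditions leave a definite decrease. -/
theorem exists_epochBounds (hN : 0 < N) (hx : LinearlySeparable x)
    (h : IsSmoothMonotoneLoss ℓ β) {a : ℝ} (ha : 0 < a) {B K : ℕ} (hK : 0 < K) (hNKB : N = K * B)
    (ha1 : a < 1 / (2 * K * β * sigmaMax x ^ 2))
    (ha2 : 0 ≤ 1 - 2 * a * β * sigmaMax x ^ 3 / maxMargin x *
      (K + (maxMargin x)⁻¹ * sigmaMax x))
    {b : ℕ → Finset (Fin N)} (hcard : ∀ k, (b k).card = B)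
    (hcover : (Finset.range K).biUnion b = Finset.univ) {w : ℕ → Vec d}
    (hw : ∀ k, w (k + 1) = w k + a • ∑ n ∈ b k, (-deriv ℓ ⟪w k, x n⟫) • x n) :
    ∃ V, EpochBounds ℓ x a K w (a * maxMargin x ^ 2 * (1 - 2 * a * β * sigmaMax x ^ 3 /
      maxMargin x * (K + (maxMargin x)⁻¹ * sigmaMax x))) V := by
  have hγ := maxMargin_pos hN hx
  have hσ := sigmaMax_pos hN hx
  have hβ := h.beta_pos
  have hK1 : (1 : ℝ) ≤ K := by exact_mod_cast hK
  set γ := maxMargin x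
  set σ := sigmaMax x
  choose m hmK hm using existsUnique_mem_of_biUnion_eq_univ hNKB hcard hcover
  set V : Fin N → ℝ := fun n => -deriv ℓ ⟪w (m n), x n⟫ with hV
  set S := ∑ n, deriv ℓ ⟪w 0, x n⟫ ^ 2 with hS
  have hS0 : 0 ≤ S := Finset.sum_nonneg fun n _ => sq_nonneg _
  have hpartial : ∀ k ≤ K, w k = w 0 + a • ∑ n, (if m n < k then V n else 0) • x n := by
    intro k
    induction k with
    | zero => intro _; simp
    | succ k ih =>
      intro hk
      have hstep : ∑ n ∈ b k, (-deriv ℓ ⟪w k, x n⟫) • x n =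
          ∑ n, (if m n = k then V n else 0) • x n := by
        rw [← Finset.sum_filter_add_sum_filter_not Finset.univ (fun n => n ∈ b k),
          Finset.sum_eq_zero (s := Finset.univ.filter fun n => ¬ n ∈ b k), add_zero]
        · rw [Finset.filter_mem_eq_inter, Finset.univ_inter]
          refine Finset.sum_congr rfl fun n hn => ?_
          have := (hm n k hk).1 hn
          simp [hV, ← this]
        · intro n hn
          have h1 := (Finset.mem_filter.1 hn).2
          have : ¬ m n = k := fun h2 => h1 ((hm n k hk).2 h2.symm)
          simp [this]
      rw [hw, hstep]
      nth_rewrite 1 [ih (by omega)]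
      rw [add_assoc, ← smul_add, ← Finset.sum_add_distrib]
      congr 2
      refine Finset.sum_congr rfl fun n _ => ?_
      rw [← add_smul]
      congr 1
      rcases lt_trichotomy (m n) k with h1 | h1 | h1
      · simp [h1, h1.ne, h1.trans (Nat.lt_succ_self k)]
      · simp [h1]
      · have h2 : ¬ m n < k + 1 := by omega
        simp [h2, h1.ne', h1.not_gt]
  have hend : w K = w 0 + a • ∑ n, V n • x n := by
    rw [hpartial K le_rfl]
    simp [hmK]
  set Q := ∑ n, V n ^ 2 with hQ
  have hQ0 : 0 ≤ Q := Finset.sum_nonneg fun n _ => sq_nonneg _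
  have hdist : ∀ k ≤ K, ‖w k - w 0‖ ^ 2 ≤ a ^ 2 * σ ^ 2 * Q := by
    intro k hk
    rw [hpartial k hk, add_sub_cancel_left, norm_smul, mul_pow, Real.norm_eq_abs, sq_abs, mul_assoc]
    refine mul_le_mul_of_nonneg_left ((norm_sum_smul_sq_le x _).trans ?_) (sq_nonneg a)
    refine mul_le_mul_of_nonneg_left (Finset.sum_le_sum fun n _ => ?_) (sq_nonneg σ)
    split_ifs
    · rfl
    · simpa using sq_nonneg (V n)
  have hdiff : ∑ n, (V n - -deriv ℓ ⟪w 0, x n⟫) ^ 2 ≤ (a * β * σ ^ 2) ^ 2 * K * Q := by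
    calc ∑ n, (V n - -deriv ℓ ⟪w 0, x n⟫) ^ 2 ≤ ∑ n, (β : ℝ) ^ 2 * ⟪w (m n) - w 0, x n⟫ ^ 2 := by
          refine Finset.sum_le_sum fun n _ => ?_
          have h1 := h.abs_deriv_sub_le ⟪w (m n), x n⟫ ⟪w 0, x n⟫
          rw [← inner_sub_left] at h1
          have h2 := pow_le_pow_left₀ (abs_nonneg _) h1 2
          rw [sq_abs, mul_pow, sq_abs] at h2
          refine le_trans (le_of_eq ?_) h2
          rw [hV]
          ring
      _ = (β : ℝ) ^ 2 * ∑ n, ⟪w (m n) - w 0, x n⟫ ^ 2 := by rw [Finset.mul_sum]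
      _ ≤ (β : ℝ) ^ 2 * ∑ n, ∑ k ∈ Finset.range K, ⟪w k - w 0, x n⟫ ^ 2 := by
          gcongr with n
          exact Finset.single_le_sum (f := fun k => ⟪w k - w 0, x n⟫ ^ 2)
            (fun k _ => sq_nonneg _) (Finset.mem_range.2 (hmK n))
      _ = (β : ℝ) ^ 2 * ∑ k ∈ Finset.range K, ∑ n, ⟪w k - w 0, x n⟫ ^ 2 := by
          rw [Finset.sum_comm]
      _ ≤ (β : ℝ) ^ 2 * ∑ k ∈ Finset.range K, σ ^ 2 * (a ^ 2 * σ ^ 2 * Q) := by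
          gcongr with k hk
          refine (sum_inner_sq_le x _).trans ?_
          gcongr
          exact hdist k (Finset.mem_range.1 hk).le
      _ = _ := by
          rw [Finset.sum_const, Finset.card_range, nsmul_eq_mul]
          ring
  have hq : 2 * K * (a * β * σ ^ 2) < 1 := by
    rw [lt_div_iff₀ (by positivity)] at ha1
    linarith
  set q := a * β * σ ^ 2 with hqdef
  have hq0 : 0 < q := by positivity
  have hqK : q ^ 2 * K ≤ 1 / 4 := by nlinarith [mul_pos hq0 (hq0.trans_le (by nlinarith : q ≤ q * K))]
  -- Self-bounding: `Q ≤ 2 q ^ 2 K Q + 2 S` with `q ^ 2 K ≤ 1 / 4`, so the `Q` on the right is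
  -- absorbed.
  have hQS : Q ≤ 4 * S := by
    have h1 : Q ≤ ∑ n, (2 * (V n - -deriv ℓ ⟪w 0, x n⟫) ^ 2 + 2 * deriv ℓ ⟪w 0, x n⟫ ^ 2) :=
      Finset.sum_le_sum fun n _ => by nlinarith [sq_nonneg (V n + 2 * deriv ℓ ⟪w 0, x n⟫)]
    rw [Finset.sum_add_distrib, ← Finset.mul_sum, ← Finset.mul_sum] at h1
    nlinarith
  set G := ∑ n, (-deriv ℓ ⟪w 0, x n⟫) • x n with hG
  set e := ∑ n, (V n - -deriv ℓ ⟪w 0, x n⟫) • x n with he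
  have hγS : γ ^ 2 * S ≤ ‖G‖ ^ 2 := by
    have := maxMargin_sq_mul_sum_sq_le hN hx (fun n => -deriv ℓ ⟪w 0, x n⟫)
      fun n => (neg_pos.2 (h.deriv_neg _)).le
    simpa only [neg_sq] using this
  have hesq : ‖e‖ ^ 2 ≤ (2 * σ * q * K) ^ 2 * S := by
    calc ‖e‖ ^ 2 ≤ σ ^ 2 * ((q ^ 2 * K) * (4 * S)) :=
          (norm_sum_smul_sq_le x _).trans (mul_le_mul_of_nonneg_left
            (hdiff.trans (by gcongr)) (sq_nonneg σ))
      -- Weakening `K` to `K ^ 2` makes the bound a perfect square and brings out the factor `K` of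
      -- the step-size condition.
      _ ≤ σ ^ 2 * ((q ^ 2 * K ^ 2) * (4 * S)) := by
          gcongr
          nlinarith
      _ = _ := by ring
  have heG : γ * ‖e‖ ≤ 2 * σ * q * K * ‖G‖ := by
    refine le_of_sq_le_sq ?_ (by positivity)
    calc (γ * ‖e‖) ^ 2 = γ ^ 2 * ‖e‖ ^ 2 := by ring
      _ ≤ γ ^ 2 * ((2 * σ * q * K) ^ 2 * S) := by gcongr
      _ = (2 * σ * q * K) ^ 2 * (γ ^ 2 * S) := by ring
      _ ≤ (2 * σ * q * K) ^ 2 * ‖G‖ ^ 2 := by gcongr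
      _ = _ := by ring
  have hdist' : ∀ k ≤ K, ‖w k - w 0‖ ^ 2 ≤ 4 * a ^ 2 * σ ^ 2 * S := fun k hk => by
    refine (hdist k hk).trans ?_
    calc a ^ 2 * σ ^ 2 * Q ≤ a ^ 2 * σ ^ 2 * (4 * S) := by gcongr
      _ = _ := by ring
  refine ⟨V, hend, fun n => ⟨m n, hmK n, rfl⟩, hQS, hdist', ?_⟩
  have hL := h.trainingLoss_add_le x (w 0) (w K - w 0)
  rw [add_sub_cancel] at hL
  have hgrad : ∑ n, deriv ℓ ⟪w 0, x n⟫ • x n = -G := by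
    simp [hG]
  have hΔ : w K - w 0 = a • (G + e) := by
    rw [hend, add_sub_cancel_left, hG, he, ← Finset.sum_add_distrib]
    simp only [← add_smul, add_sub_cancel]
  have hinner : ⟪w K - w 0, ∑ n, deriv ℓ ⟪w 0, x n⟫ • x n⟫ ≤ -(a * ‖G‖ ^ 2) + a * (‖e‖ * ‖G‖) := by
    rw [hgrad, hΔ, inner_smul_left, inner_neg_right, inner_add_left, real_inner_self_eq_norm_sq,
      conj_trivial]
    have := (abs_le.1 (abs_real_inner_le_norm e G)).1
    nlinarith
  have h1 : a * (‖e‖ * ‖G‖) ≤ a * (2 * σ * q * K / γ * ‖G‖ ^ 2) := by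
    refine mul_le_mul_of_nonneg_left ?_ ha.le
    calc ‖e‖ * ‖G‖ ≤ (2 * σ * q * K * ‖G‖ / γ) * ‖G‖ := by
          gcongr
          rw [le_div_iff₀ hγ]
          linarith
      _ = _ := by ring
  have h2 : (β : ℝ) / 2 * (σ ^ 2 * ‖w K - w 0‖ ^ 2) ≤
      a * (2 * a * β * σ ^ 4 / γ ^ 2) * ‖G‖ ^ 2 := by
    calc (β : ℝ) / 2 * (σ ^ 2 * ‖w K - w 0‖ ^ 2) ≤ β / 2 * (σ ^ 2 * (4 * a ^ 2 * σ ^ 2 * S)) := by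
          gcongr
          exact hdist' K le_rfl
      _ = a * (2 * a * β * σ ^ 4 / γ ^ 2) * (γ ^ 2 * S) := by field_simp; ring
      _ ≤ _ := by gcongr
  have h3 : a * ‖G‖ ^ 2 * (1 - 2 * a * β * σ ^ 3 / γ * (K + γ⁻¹ * σ)) =
      a * ‖G‖ ^ 2 - a * (2 * σ * q * K / γ * ‖G‖ ^ 2) -
        a * (2 * a * β * σ ^ 4 / γ ^ 2) * ‖G‖ ^ 2 := by
    rw [hqdef]
    field_simp
    ring
  have h4 : a * (γ ^ 2 * S) * (1 - 2 * a * β * σ ^ 3 / γ * (K + γ⁻¹ * σ)) ≤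
      a * ‖G‖ ^ 2 * (1 - 2 * a * β * σ ^ 3 / γ * (K + γ⁻¹ * σ)) := by
    gcongr
  linarith

theorem summable_of_descent {L S : ℕ → ℝ} {c : ℝ} (hc : 0 < c) (hL : ∀ t, 0 ≤ L t)
    (hS : ∀ t, 0 ≤ S t) (h : ∀ t, L (t + 1) ≤ L t - c * S t) : Summable S := by
  refine summable_of_sum_range_le (c := L 0 / c) hS fun t => ?_
  rw [le_div_iff₀ hc]
  have : L t ≤ L 0 - c * ∑ s ∈ Finset.range t, S s := by
    induction t with
    | zero => simp
    | succ t ih =>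
      rw [Finset.sum_range_succ]
      linarith [h t]
  linarith [hL t]

/-- Converts epoch time to iteration time; in the initial epoch `Real.log 0 = 0` is the value in
play. -/
theorem abs_log_sub_log_div_le {K : ℕ} (hK : 0 < K) (t : ℕ) :
    |Real.log t - Real.log (t / K : ℕ)| ≤ Real.log (2 * K) := by
  have hK1 : (1 : ℝ) ≤ K := by exact_mod_cast hK
  have hmod := Nat.div_add_mod t K
  have hlt := Nat.mod_lt t hK
  rcases Nat.eq_zero_or_pos (t / K) with h0 | hpos
  · rw [h0, Nat.cast_zero, Real.log_zero, sub_zero, abs_of_nonneg (Real.log_natCast_nonneg t)]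
    rcases t.eq_zero_or_pos with rfl | ht
    · simpa using Real.log_nonneg (by linarith : (1 : ℝ) ≤ 2 * K)
    · refine Real.log_le_log (by exact_mod_cast ht) ?_
      have : t ≤ 2 * K := by
        rw [h0] at hmod
        omega
      exact_mod_cast this
  · have ht : 0 < t := lt_of_lt_of_le hpos (Nat.div_le_self t K)
    have ht' : (0 : ℝ) < t := by exact_mod_cast ht
    have hu' : (0 : ℝ) < (t / K : ℕ) := by exact_mod_cast hpos
    rw [abs_of_nonneg]
    · rw [sub_le_iff_le_add, ← Real.log_mul (by positivity) hu'.ne']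
      refine Real.log_le_log ht' ?_
      have : t ≤ 2 * K * (t / K) := by
        have := Nat.mul_le_mul_left K hpos
        nlinarith
      exact_mod_cast this
    · exact sub_nonneg.2 (Real.log_le_log hu' (by exact_mod_cast Nat.div_le_self t K))

theorem exists_norm_sgd_sub_le_of_withoutReplacement (hN : 0 < N) (hx : LinearlySeparable x)
    (h : IsSmoothMonotoneLoss ℓ β) (htail : HasTightExponentialTail fun u => -deriv ℓ u)
    {what : Vec d} {α : Fin N → ℝ} (hα : IsStrictDual x what α) {η : ℝ} (hη : 0 < η)
    {B K : ℕ} (hNKB : N = K * B)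
    (hstep : η / B < min (1 / (2 * K * β * sigmaMax x ^ 2)) (maxMargin x /
      (2 * β * sigmaMax x ^ 3 * (K + (maxMargin x)⁻¹ * sigmaMax x))))
    {batch : ℕ → Finset (Fin N)} (hbatch : SamplesWithoutReplacement B K batch) (w₀ : Vec d) :
    ∃ R, ∀ t : ℕ, ‖sgd ℓ x η B batch w₀ t - Real.log t • what‖ ≤ R := by
  have hK : 0 < K := Nat.pos_of_ne_zero (by rintro rfl; simp at hNKB; omega)
  have hB : 0 < B := Nat.pos_of_ne_zero (by rintro rfl; simp at hNKB; omega)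
  have hK1 : (1 : ℝ) ≤ K := by exact_mod_cast hK
  have hγ := maxMargin_pos hN hx
  have hσ := sigmaMax_pos hN hx
  have hβ := h.beta_pos
  set a := η / B with ha
  have ha0 : 0 < a := by positivity
  obtain ⟨hs1, hs2⟩ := lt_min_iff.1 hstep
  have hc0 : 0 < 1 - 2 * a * β * sigmaMax x ^ 3 / maxMargin x *
      (K + (maxMargin x)⁻¹ * sigmaMax x) := by
    rw [lt_div_iff₀ (by positivity)] at hs2
    rw [sub_pos, div_mul_eq_mul_div, div_lt_one hγ]
    linarith
  set c := a * maxMargin x ^ 2 * (1 - 2 * a * β * sigmaMax x ^ 3 / maxMargin x *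
      (K + (maxMargin x)⁻¹ * sigmaMax x)) with hc
  have hcpos : 0 < c := by positivity
  set w := sgd ℓ x η B batch w₀ with hw
  have hepoch : ∀ u, ∃ V, EpochBounds ℓ x a K (fun k => w (K * u + k)) c V := fun u =>
    exists_epochBounds hN hx h ha0 hK hNKB hs1 hc0.le (b := fun k => batch (K * u + k))
      (fun k => hbatch.card_eq _) (hbatch.epoch u) fun k => sgd_succ _ _ _ _ _ _ _
  choose V hV using hepoch
  have hnext : ∀ u, w (K * (u + 1)) = w (K * u) + ∑ n, (a * V u n) • x n := fun u => by
    simpa only [mul_add, mul_one, mul_zero, add_zero, mul_smul, ← Finset.smul_sum] using (hV u).end_eq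
  set S : ℕ → ℝ := fun u => ∑ n, deriv ℓ ⟪w (K * u), x n⟫ ^ 2 with hS
  have hS0 : ∀ u, 0 ≤ S u := fun u => Finset.sum_nonneg fun n _ => sq_nonneg _
  have hSsum : Summable S := by
    refine summable_of_descent hcpos (fun u => h.trainingLoss_nonneg x (w (K * u))) hS0 fun u => ?_
    simpa only [mul_add, mul_one, mul_zero, add_zero] using (hV u).loss_le
  have hsub : ∀ u, ∀ k ≤ K, ‖w (K * u + k) - w (K * u)‖ ^ 2 ≤
      4 * a ^ 2 * sigmaMax x ^ 2 * S u := fun u k hk => by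
    simpa only [add_zero] using (hV u).norm_sub_sq_le k hk
  have hVsum : ∀ n, Summable fun u => (a * V u n) ^ 2 := fun n => by
    simp only [mul_pow]
    refine (Summable.of_nonneg_of_le (fun u => sq_nonneg _) (fun u => ?_)
      (hSsum.mul_left 4)).mul_left _
    exact (Finset.single_le_sum (f := fun n => V u n ^ 2) (fun n _ => sq_nonneg _)
      (Finset.mem_univ n)).trans (by simpa only [add_zero] using (hV u).sum_sq_le)
  have hmargin : ∀ n, Tendsto (fun u => ⟪w (K * u), x n⟫) atTop atTop := fun n =>
    h.tendsto_atTop_of_summable_sq (Summable.of_nonneg_of_le (fun u => sq_nonneg _)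
      (fun u => Finset.single_le_sum (f := fun n => deriv ℓ ⟪w (K * u), x n⟫ ^ 2)
        (fun n _ => sq_nonneg _) (Finset.mem_univ n)) hSsum)
  obtain ⟨U, hU⟩ := IsSmoothMonotoneLoss.exists_tail_bounds htail
  -- The factors `exp (∓1)` come from margins moving by at most `1` within a late epoch, since that
  -- movement is controlled by `S u → 0`.
  have hdriven : IsExpDriven x (fun u => w (K * u)) (fun u n => a * V u n)
      (a * (1 / 2 * Real.exp (-1))) (a * (2 * Real.exp 1)) := by
    refine ⟨hnext, ?_, hVsum⟩
    rw [eventually_all]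
    intro n
    have hsmall : ∀ᶠ u in atTop, 4 * a ^ 2 * sigmaMax x ^ 2 * S u * ‖x n‖ ^ 2 < 1 := by
      have := (hSsum.tendsto_atTop_zero.const_mul (4 * a ^ 2 * sigmaMax x ^ 2)).mul_const
        (‖x n‖ ^ 2)
      rw [mul_zero, zero_mul] at this
      exact this.eventually_lt_const one_pos
    filter_upwards [hsmall, (hmargin n).eventually_gt_atTop (U + 1)] with u h1 h2
    obtain ⟨k, hk, hVk⟩ := (hV u).eq_neg_deriv n
    have h3 : |⟪w (K * u + k) - w (K * u), x n⟫| ≤ 1 := by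
      refine abs_le_of_sq_le_sq ?_ one_pos.le
      rw [one_pow, ← sq_abs]
      refine le_trans ?_ h1.le
      refine (pow_le_pow_left₀ (abs_nonneg _) (abs_real_inner_le_norm _ _) 2).trans ?_
      rw [mul_pow]
      exact mul_le_mul_of_nonneg_right (hsub u k hk.le) (sq_nonneg _)
    rw [inner_sub_left, abs_le] at h3
    obtain ⟨h4, h5⟩ := hU ⟪w (K * u + k), x n⟫ (by linarith)
    rw [← hVk] at h4 h5
    constructor
    · rw [mul_assoc, mul_assoc, ← Real.exp_add]
      refine mul_le_mul_of_nonneg_left (le_trans ?_ h4) ha0.le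
      gcongr
      linarith
    · rw [mul_assoc, mul_assoc, ← Real.exp_add]
      refine mul_le_mul_of_nonneg_left (h5.trans ?_) ha0.le
      gcongr
      linarith
  obtain ⟨R, hR⟩ := hdriven.exists_norm_sub_log_smul_le (by positivity) hα
  set D := 4 * a ^ 2 * sigmaMax x ^ 2 * ∑' u, S u with hD
  refine ⟨(D + 1) + R + Real.log (2 * K) * ‖what‖, fun t => ?_⟩
  have ht := Nat.div_add_mod t K
  set u := t / K with hu
  have h1 : ‖w t - w (K * u)‖ ≤ D + 1 := by
    have h2 := hsub u (t % K) (Nat.mod_lt t hK).le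
    rw [ht] at h2
    have h3 : ‖w t - w (K * u)‖ ^ 2 ≤ D := h2.trans (by
      rw [hD]
      gcongr
      exact hSsum.le_tsum u fun _ _ => hS0 _)
    nlinarith [sq_nonneg (‖w t - w (K * u)‖ - 1)]
  have h2 : ‖(Real.log u - Real.log t) • what‖ ≤ Real.log (2 * K) * ‖what‖ := by
    rw [norm_smul, Real.norm_eq_abs, abs_sub_comm]
    exact mul_le_mul_of_nonneg_right (abs_log_sub_log_div_le hK t) (norm_nonneg _)
  have h3 : w t - Real.log t • what = (w t - w (K * u)) + (w (K * u) - Real.log u • what) +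
      (Real.log u - Real.log t) • what := by
    rw [sub_smul]; abel
  rw [h3]
  exact (norm_add₃_le).trans (add_le_add (add_le_add h1 (hR u)) h2)

end WithoutReplacement

/-! ### Sampling with replacement: adaptedness and the noise martingale. -/

section WithReplacement

variable {N d : ℕ} {x : Dataset N d} {ℓ : ℝ → ℝ} {β : ℝ≥0} {Ω : Type*}

/-- The minibatches drawn before time `t`. -/
def past (batch : ℕ → Ω → Finset (Fin N)) (t : ℕ) (ω : Ω) : Finset.range t → Finset (Fin N) :=
  fun i => batch i ω

theorem past_eq_iff {batch : ℕ → Ω → Finset (Fin N)} {t : ℕ} {ω ω' : Ω} :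
    past batch t ω = past batch t ω' ↔ ∀ i < t, batch i ω = batch i ω' := by
  constructor
  · exact fun h i hi => congrFun h ⟨i, Finset.mem_range.2 hi⟩
  · exact fun h => funext fun i => h i (Finset.mem_range.1 i.2)

theorem past_factorsThrough_past (batch : ℕ → Ω → Finset (Fin N)) {s t : ℕ} (hst : s ≤ t) :
    (past batch s).FactorsThrough (past batch t) := fun _ _ h =>
  past_eq_iff.2 fun i hi => past_eq_iff.1 h i (hi.trans_le hst)

theorem sgd_congr {η : ℝ} {B : ℕ} {b b' : ℕ → Finset (Fin N)} {w₀ : Vec d} {t : ℕ}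
    (h : ∀ i < t, b i = b' i) : sgd ℓ x η B b w₀ t = sgd ℓ x η B b' w₀ t := by
  induction t with
  | zero => rfl
  | succ t ih => rw [sgd, sgd, ih fun i hi => h i (hi.trans t.lt_succ_self), h t t.lt_succ_self]

theorem sgd_factorsThrough_past (batch : ℕ → Ω → Finset (Fin N)) (η : ℝ) (B : ℕ) (w₀ : Vec d)
    (t : ℕ) : (fun ω => sgd ℓ x η B (fun i => batch i ω) w₀ t).FactorsThrough (past batch t) :=
  fun _ _ h => sgd_congr (past_eq_iff.1 h)

/-- The accumulated sampling noise of `∑ φ s` when the term `φ s` is only kept if index `n` is drawn at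
time `s`. -/
noncomputable def noise (batch : ℕ → Ω → Finset (Fin N)) (n : Fin N) (φ : ℕ → Ω → ℝ) (B t : ℕ) (ω : Ω) : ℝ :=
  ∑ s ∈ Finset.range t, ((if n ∈ batch s ω then 1 else 0) - (B : ℝ) / N) * φ s ω

theorem noise_factorsThrough {B : ℕ} {batch : ℕ → Ω → Finset (Fin N)} {n : Fin N} {φ : ℕ → Ω → ℝ}
    (hφ : ∀ t, (φ t).FactorsThrough (past batch t)) (t : ℕ) :
    (noise batch n φ B t).FactorsThrough (past batch t) := by
  intro ω ω' he
  refine Finset.sum_congr rfl fun s hs => ?_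
  have hst := Finset.mem_range.1 hs
  have h2 := hφ s (past_factorsThrough_past batch hst.le he)
  have h3 := past_eq_iff.1 he s hst
  simp only [h2, h3]

variable [MeasurableSpace Ω] {P : Measure Ω}
  {B : ℕ} {batch : ℕ → Ω → Finset (Fin N)}

theorem ae_summable_of_summable_integral {S : ℕ → Ω → ℝ} (hint : ∀ t, Integrable (S t) P)
    (h0 : ∀ t ω, 0 ≤ S t ω) (hsum : Summable fun t => ∫ ω, S t ω ∂P) :
    ∀ᵐ ω ∂P, Summable fun t => S t ω := by
  have h1 : ∫⁻ ω, ∑' t, ENNReal.ofReal (S t ω) ∂P ≠ ∞ := by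
    rw [lintegral_tsum fun t => (hint t).aemeasurable.ennreal_ofReal]
    have : ∀ t, ∫⁻ ω, ENNReal.ofReal (S t ω) ∂P = ENNReal.ofReal (∫ ω, S t ω ∂P) := fun t =>
      (ofReal_integral_eq_lintegral_ofReal (hint t) (Eventually.of_forall (h0 t))).symm
    simp only [this]
    exact hsum.tsum_ofReal_ne_top
  filter_upwards [ae_lt_top' (AEMeasurable.tsum
    fun t => (hint t).aemeasurable.ennreal_ofReal) h1] with ω hω
  have := ENNReal.summable_toReal hω.ne
  simpa only [ENNReal.toReal_ofReal (h0 _ ω)] using this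

namespace SamplesWithReplacement

theorem measurable_past (h : SamplesWithReplacement P B batch) (t : ℕ) :
    Measurable[_, ⊤] (past batch t) := by
  let _ : MeasurableSpace (Finset.range t → Finset (Fin N)) := ⊤
  refine measurable_to_countable' fun y => ?_
  have : past batch t ⁻¹' {y} = ⋂ i : Finset.range t, {ω | batch i ω = y i} := by
    ext ω
    simp only [Set.mem_preimage, Set.mem_singleton_iff, Set.mem_iInter, Set.mem_ofPred_eq]
    exact funext_iff
  rw [this]
  exact MeasurableSet.iInter fun i => h.measurable i (y i)

theorem measurable_of_factorsThrough (h : SamplesWithReplacement P B batch) {t : ℕ} {φ : Ω → ℝ}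
    (hφ : φ.FactorsThrough (past batch t)) : Measurable φ := by
  obtain ⟨F, rfl⟩ := (Function.factorsThrough_iff φ).1 hφ
  let _ : MeasurableSpace (Finset.range t → Finset (Fin N)) := ⊤
  exact measurable_from_top.comp (h.measurable_past t)

/-- The current batch is independent of the past, so the expectation factors, and uniformity
supplies `B / N`. -/
theorem integral_ite_mul (h : SamplesWithReplacement P B batch) {t : ℕ} {φ : Ω → ℝ}
    (hφ : φ.FactorsThrough (past batch t)) (n : Fin N) :
    ∫ ω, (if n ∈ batch t ω then 1 else 0) * φ ω ∂P = (B : ℝ) / N * ∫ ω, φ ω ∂P := by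
  let _ : MeasurableSpace (Finset (Fin N)) := ⊤
  have : DiscreteMeasurableSpace (Finset (Fin N)) := ⟨fun _ => trivial⟩
  have hmeas : ∀ i, Measurable (batch i) := fun i =>
    measurable_to_countable' fun y => h.measurable i y
  obtain ⟨F, rfl⟩ := (Function.factorsThrough_iff φ).1 hφ
  have hind := (iIndepFun.indepFun_finset (Finset.range t) {t} (by simp) h.indep hmeas).symm
  let G : (({t} : Finset ℕ) → Finset (Fin N)) → ℝ := fun y =>
    if n ∈ y ⟨t, Finset.mem_singleton_self t⟩ then 1 else 0
  have hG : Measurable G := measurable_of_countable G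
  have hF : Measurable F := measurable_of_countable F
  have hGF := (hind.comp hG hF).integral_fun_mul_eq_mul_integral
    (hG.comp (measurable_pi_lambda _ fun i => hmeas i)).aestronglyMeasurable
    (hF.comp (measurable_pi_lambda _ fun i => hmeas i)).aestronglyMeasurable
  refine Eq.trans hGF ?_
  congr 1
  have hset : MeasurableSet {ω | n ∈ batch t ω} :=
    hmeas t (MeasurableSet.of_discrete (s := {s | n ∈ s}))
  rw [← h.uniform t n, ← integral_indicator_one hset]
  refine integral_congr_ae (Eventually.of_forall fun ω => ?_)
  simp [G, Set.indicator_apply]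

variable [IsProbabilityMeasure P]

/-- There are only finitely many pasts, so such a function is bounded. -/
theorem integrable_of_factorsThrough (h : SamplesWithReplacement P B batch) {t : ℕ} {φ : Ω → ℝ}
    (hφ : φ.FactorsThrough (past batch t)) : Integrable φ P := by
  have hm := h.measurable_of_factorsThrough hφ
  obtain ⟨F, rfl⟩ := (Function.factorsThrough_iff φ).1 hφ
  refine Integrable.of_bound hm.aestronglyMeasurable (∑ y, ‖F y‖) (Eventually.of_forall fun ω => ?_)
  exact Finset.single_le_sum (f := fun y => ‖F y‖) (fun _ _ => norm_nonneg _) (Finset.mem_univ _)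

theorem integral_centered_mul (h : SamplesWithReplacement P B batch) {t : ℕ} {φ : Ω → ℝ}
    (hφ : φ.FactorsThrough (past batch t)) (n : Fin N) :
    ∫ ω, ((if n ∈ batch t ω then 1 else 0) - (B : ℝ) / N) * φ ω ∂P = 0 := by
  have h1 : Integrable (fun ω => (if n ∈ batch t ω then 1 else 0) * φ ω) P := by
    refine h.integrable_of_factorsThrough (t := t + 1) fun ω ω' he => ?_
    have h2 := hφ (past_factorsThrough_past batch t.le_succ he)
    have h3 := past_eq_iff.1 he t t.lt_succ_self
    simp only [h2, h3]
  simp only [sub_mul]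
  rw [integral_sub h1 ((h.integrable_of_factorsThrough hφ).const_mul _), h.integral_ite_mul hφ,
    integral_const_mul, sub_self]

/-- The filtration generated by the minibatches. -/
def filtration (h : SamplesWithReplacement P B batch) : Filtration ℕ (inferInstance :
    MeasurableSpace Ω) where
  seq t := MeasurableSpace.comap (past batch t) ⊤
  mono' s t hst := by
    obtain ⟨F, hF⟩ := (Function.factorsThrough_iff _).1 (past_factorsThrough_past batch hst)
    dsimp only
    rw [hF, ← MeasurableSpace.comap_comp]
    exact MeasurableSpace.comap_mono le_top
  le' t := (h.measurable_past t).comap_le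

theorem martingale_noise (h : SamplesWithReplacement P B batch) (n : Fin N) {φ : ℕ → Ω → ℝ}
    (hφ : ∀ t, (φ t).FactorsThrough (past batch t)) :
    Martingale (noise batch n φ B) h.filtration P := by
  have hint : ∀ t, Integrable (noise batch n φ B t) P := fun t =>
    h.integrable_of_factorsThrough (noise_factorsThrough hφ t)
  refine martingale_of_condExp_sub_eq_zero_nat (fun t => ?_) hint fun t => ?_
  · obtain ⟨F, hF⟩ := (Function.factorsThrough_iff _).1 (noise_factorsThrough (B := B) (n := n) hφ t)
    rw [hF]
    let _ : MeasurableSpace (Finset.range t → Finset (Fin N)) := ⊤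
    exact (measurable_from_top.comp (comap_measurable (past batch t))).stronglyMeasurable
  · symm
    refine ae_eq_condExp_of_forall_setIntegral_eq (h.filtration.le t)
      ((hint (t + 1)).sub (hint t)) (fun s _ _ => integrableOn_zero) (fun s hs _ => ?_)
      aestronglyMeasurable_zero
    obtain ⟨A, -, rfl⟩ := hs
    have hA : MeasurableSet (past batch t ⁻¹' A) := h.measurable_past t trivial
    -- Restricting `φ t` to a past event keeps it determined by the past, so the centering identity
    -- applies to each set integral of the increment.
    have hψ : (fun ω => (past batch t ⁻¹' A).indicator (φ t) ω).FactorsThrough (past batch t) := by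
      intro ω ω' he
      have hiff : ω ∈ past batch t ⁻¹' A ↔ ω' ∈ past batch t ⁻¹' A := by
        rw [Set.mem_preimage, Set.mem_preimage, he]
      by_cases hω : ω ∈ past batch t ⁻¹' A
      · simp only [Set.indicator_of_mem hω, Set.indicator_of_mem (hiff.1 hω), hφ t he]
      · simp only [Set.indicator_of_notMem hω, Set.indicator_of_notMem (mt hiff.2 hω)]
    rw [← integral_indicator hA, ← integral_indicator hA]
    refine Eq.trans ?_ (h.integral_centered_mul hψ n).symm |>.trans ?_
    · simp
    · refine integral_congr_ae (Eventually.of_forall fun ω => ?_)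
      by_cases hω : ω ∈ past batch t ⁻¹' A
      · simp [hω, noise, Finset.sum_range_succ]
      · simp [hω]

/-- Martingale increments are orthogonal, and the centered indicator has absolute value at most `1`.
-/
theorem integral_noise_sq_le (h : SamplesWithReplacement P B batch) (hBN : B ≤ N) (n : Fin N)
    {φ : ℕ → Ω → ℝ} (hφ : ∀ t, (φ t).FactorsThrough (past batch t)) (t : ℕ) :
    ∫ ω, noise batch n φ B t ω ^ 2 ∂P ≤ ∑ s ∈ Finset.range t, ∫ ω, φ s ω ^ 2 ∂P := by
  induction t with
  | zero => simp [noise]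
  | succ t ih =>
    rw [Finset.sum_range_succ]
    have hq0 : 0 ≤ (B : ℝ) / N := by positivity
    have hq1 : (B : ℝ) / N ≤ 1 := div_le_one_of_le₀ (by exact_mod_cast hBN) (Nat.cast_nonneg N)
    have hM := noise_factorsThrough (B := B) (n := n) hφ t
    have hprod : (fun ω => noise batch n φ B t ω * φ t ω).FactorsThrough (past batch t) :=
      fun ω ω' he => by simp only [hM he, hφ t he]
    have hcross := h.integral_centered_mul hprod n
    have i1 : Integrable (fun ω => noise batch n φ B t ω ^ 2) P :=
      h.integrable_of_factorsThrough (t := t) fun ω ω' he => by simp only [hM he]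
    have i2 : Integrable (fun ω => φ t ω ^ 2) P :=
      h.integrable_of_factorsThrough (t := t) fun ω ω' he => by simp only [hφ t he]
    have i3 : Integrable (fun ω => ((if n ∈ batch t ω then 1 else 0) - (B : ℝ) / N) *
        (noise batch n φ B t ω * φ t ω)) P := by
      refine h.integrable_of_factorsThrough (t := t + 1) fun ω ω' he => ?_
      have h2 := hprod (past_factorsThrough_past batch t.le_succ he)
      have h3 := past_eq_iff.1 he t t.lt_succ_self
      simp only at h2
      simp only [h2, h3]
    have i4 : Integrable (fun ω => noise batch n φ B (t + 1) ω ^ 2) P :=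
      h.integrable_of_factorsThrough (t := t + 1) fun ω ω' he => by
        simp only [noise_factorsThrough (B := B) (n := n) hφ (t + 1) he]
    calc ∫ ω, noise batch n φ B (t + 1) ω ^ 2 ∂P
        ≤ ∫ ω, (noise batch n φ B t ω ^ 2 + φ t ω ^ 2 +
          2 * (((if n ∈ batch t ω then 1 else 0) - (B : ℝ) / N) *
            (noise batch n φ B t ω * φ t ω))) ∂P := by
          refine integral_mono i4 ((i1.add i2).add (i3.const_mul 2)) fun ω => ?_
          have hs : noise batch n φ B (t + 1) ω = noise batch n φ B t ω +
            ((if n ∈ batch t ω then 1 else 0) - (B : ℝ) / N) * φ t ω := Finset.sum_range_succ _ _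
          simp only
          rw [hs]
          have hξ : ((if n ∈ batch t ω then 1 else 0) - (B : ℝ) / N) ^ 2 ≤ 1 := by
            split_ifs <;> nlinarith
          nlinarith [mul_le_mul_of_nonneg_right hξ (sq_nonneg (φ t ω))]
      _ = ∫ ω, noise batch n φ B t ω ^ 2 ∂P + ∫ ω, φ t ω ^ 2 ∂P := by
          refine (integral_add (i1.add i2) (i3.const_mul 2)).trans ?_
          rw [integral_const_mul, hcross, mul_zero, add_zero]
          exact integral_add i1 i2
      _ ≤ _ := by gcongr

/-- The `L²` bound gives an `L¹` bound through `|z| ≤ 1 + z ^ 2`; martingale convergence then gives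
almost sure convergence, hence boundedness. -/
theorem ae_bounded_noise (h : SamplesWithReplacement P B batch) (hBN : B ≤ N) (n : Fin N)
    {φ : ℕ → Ω → ℝ} (hφ : ∀ t, (φ t).FactorsThrough (past batch t))
    (hsum : Summable fun t => ∫ ω, φ t ω ^ 2 ∂P) :
    ∀ᵐ ω ∂P, ∃ C, ∀ t, |noise batch n φ B t ω| ≤ C := by
  have hbdd : ∀ t, eLpNorm (noise batch n φ B t) 1 P ≤
      ((1 + ∑' t, ∫ ω, φ t ω ^ 2 ∂P).toNNReal : ℝ≥0∞) := by
    intro t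
    have hM := noise_factorsThrough (B := B) (n := n) hφ t
    have i0 := h.integrable_of_factorsThrough hM
    have i1 : Integrable (fun ω => noise batch n φ B t ω ^ 2) P :=
      h.integrable_of_factorsThrough (t := t) fun ω ω' he => by simp only [hM he]
    rw [eLpNorm_one_eq_lintegral_enorm, ← ofReal_integral_norm_eq_lintegral_enorm i0]
    refine ENNReal.ofReal_le_ofReal ?_
    calc ∫ ω, ‖noise batch n φ B t ω‖ ∂P ≤ ∫ ω, (1 + noise batch n φ B t ω ^ 2) ∂P := by
          refine integral_mono i0.norm ((integrable_const 1).add i1) fun ω => ?_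
          simp only [Real.norm_eq_abs]
          rw [← sq_abs]
          nlinarith [sq_nonneg (|noise batch n φ B t ω| - 1)]
      _ = 1 + ∫ ω, noise batch n φ B t ω ^ 2 ∂P := by
          rw [integral_add (integrable_const 1) i1]
          simp
      _ ≤ _ := by
          gcongr
          exact (h.integral_noise_sq_le hBN n hφ t).trans (hsum.sum_le_tsum _ fun _ _ =>
            integral_nonneg fun _ => sq_nonneg _)
  filter_upwards [(h.martingale_noise n hφ).submartingale.exists_ae_tendsto_of_bdd hbdd]
    with ω ⟨c, hc⟩
  obtain ⟨C, hC⟩ := hc.abs.bddAbove_range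
  exact ⟨C, fun t => hC ⟨t, rfl⟩⟩

end SamplesWithReplacement

end WithReplacement

/-! ### Sampling with replacement: descent in expectation and bounded residual. -/

section WithReplacementConvergence

variable {N d : ℕ} {x : Dataset N d} {ℓ : ℝ → ℝ} {β : ℝ≥0} {Ω : Type*} [MeasurableSpace Ω]
  {P : Measure Ω} [IsProbabilityMeasure P] {B : ℕ} {batch : ℕ → Ω → Finset (Fin N)}

theorem sum_smul_eq_sum_ite_mul_smul (b : Finset (Fin N)) (g : Fin N → ℝ) :
    ∑ n ∈ b, g n • x n = ∑ n, ((if n ∈ b then 1 else 0) * g n) • x n := by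
  simp [ite_smul]

/-- The squared step is bounded through `σ` by a sum that is linear in the batch indicators. Taking
expectations then needs only the inclusion probability of each index, not the joint law of pairs. -/
theorem trainingLoss_minibatch_step_le (h : IsSmoothMonotoneLoss ℓ β) (x : Dataset N d) (a : ℝ)
    (b : Finset (Fin N)) (w : Vec d) :
    trainingLoss ℓ x (w + a • ∑ n ∈ b, (-deriv ℓ ⟪w, x n⟫) • x n) ≤ trainingLoss ℓ x w +
      ∑ n, (if n ∈ b then 1 else 0) * (a * (deriv ℓ ⟪w, x n⟫ *
        ⟪x n, ∑ m, (-deriv ℓ ⟪w, x m⟫) • x m⟫) +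
          β / 2 * a ^ 2 * sigmaMax x ^ 4 * deriv ℓ ⟪w, x n⟫ ^ 2) := by
  rw [sum_smul_eq_sum_ite_mul_smul]
  set G := ∑ m, (-deriv ℓ ⟪w, x m⟫) • x m with hG
  set u := ∑ n, ((if n ∈ b then 1 else 0) * -deriv ℓ ⟪w, x n⟫) • x n with hu
  have h1 := h.trainingLoss_add_le x w (a • u)
  have h2 : ⟪a • u, ∑ n, deriv ℓ ⟪w, x n⟫ • x n⟫ =
      ∑ n, (if n ∈ b then 1 else 0) * (a * (deriv ℓ ⟪w, x n⟫ * ⟪x n, G⟫)) := by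
    have : ∑ n, deriv ℓ ⟪w, x n⟫ • x n = -G := by simp [hG]
    rw [this, inner_smul_left, inner_neg_right, hu, sum_inner, conj_trivial, mul_neg, ← neg_mul,
      Finset.mul_sum]
    refine Finset.sum_congr rfl fun n _ => ?_
    rw [inner_smul_left, conj_trivial]
    ring
  have h3 : ‖a • u‖ ^ 2 ≤ a ^ 2 * (sigmaMax x ^ 2 *
      ∑ n, (if n ∈ b then 1 else 0) * deriv ℓ ⟪w, x n⟫ ^ 2) := by
    rw [norm_smul, mul_pow, Real.norm_eq_abs, sq_abs]
    refine mul_le_mul_of_nonneg_left ((norm_sum_smul_sq_le x _).trans (le_of_eq ?_)) (sq_nonneg a)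
    congr 1
    refine Finset.sum_congr rfl fun n _ => ?_
    split_ifs <;> ring
  have h4 : (β : ℝ) / 2 * (sigmaMax x ^ 2 * ‖a • u‖ ^ 2) ≤
      ∑ n, (if n ∈ b then 1 else 0) *
        (β / 2 * a ^ 2 * sigmaMax x ^ 4 * deriv ℓ ⟪w, x n⟫ ^ 2) := by
    calc (β : ℝ) / 2 * (sigmaMax x ^ 2 * ‖a • u‖ ^ 2) ≤ β / 2 * (sigmaMax x ^ 2 *
          (a ^ 2 * (sigmaMax x ^ 2 *
            ∑ n, (if n ∈ b then 1 else 0) * deriv ℓ ⟪w, x n⟫ ^ 2))) := by gcongr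
      _ = (β / 2 * a ^ 2 * sigmaMax x ^ 4) *
            ∑ n, (if n ∈ b then 1 else 0) * deriv ℓ ⟪w, x n⟫ ^ 2 := by ring
      _ = _ := by
        rw [Finset.mul_sum]
        exact Finset.sum_congr rfl fun n _ => by ring
  simp only [mul_add (ite _ _ _), Finset.sum_add_distrib]
  linarith

theorem SamplesWithReplacement.summable_integral_sum_deriv_sq (hN : 0 < N)
    (hx : LinearlySeparable x) (h : IsSmoothMonotoneLoss ℓ β) {η : ℝ} (hη : 0 < η) (hB : 0 < B)
    (hstep : η / B < 2 * maxMargin x ^ 2 / (β * sigmaMax x ^ 4))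
    (hb : SamplesWithReplacement P B batch) (w₀ : Vec d) :
    Summable fun t => ∫ ω, ∑ n,
      deriv ℓ ⟪sgd ℓ x η B (fun i => batch i ω) w₀ t, x n⟫ ^ 2 ∂P := by
  have hγ := maxMargin_pos hN hx
  have hσ := sigmaMax_pos hN hx
  have hβ := h.beta_pos
  have hN' : (0 : ℝ) < N := by exact_mod_cast hN
  set a := η / B with ha
  have ha0 : 0 < a := by positivity
  have hc : 0 < maxMargin x ^ 2 - a * β * sigmaMax x ^ 4 / 2 := by
    rw [lt_div_iff₀ (by positivity)] at hstep
    linarith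
  set w : ℕ → Ω → Vec d := fun t ω => sgd ℓ x η B (fun i => batch i ω) w₀ t with hw
  have hwf : ∀ t, (w t).FactorsThrough (past batch t) := fun t =>
    sgd_factorsThrough_past batch η B w₀ t
  have hint : ∀ (f : Vec d → ℝ) t, Integrable (fun ω => f (w t ω)) P := fun f t =>
    hb.integrable_of_factorsThrough (t := t) fun ω ω' he => by simp only [hwf t he]
  have hint' : ∀ (f : Vec d → ℝ) t n,
      Integrable (fun ω => (if n ∈ batch t ω then 1 else 0) * f (w t ω)) P := fun f t n =>
    hb.integrable_of_factorsThrough (t := t + 1) fun ω ω' he => by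
      simp only [hwf t (past_factorsThrough_past batch t.le_succ he),
        past_eq_iff.1 he t t.lt_succ_self]
  have hexp : ∀ (f : Vec d → ℝ) t n, ∫ ω, (if n ∈ batch t ω then 1 else 0) * f (w t ω) ∂P =
      (B : ℝ) / N * ∫ ω, f (w t ω) ∂P := fun f t n =>
    hb.integral_ite_mul (fun ω ω' he => by simp only [hwf t he]) n
  let ψ : Fin N → Vec d → ℝ := fun n u => a * (deriv ℓ ⟪u, x n⟫ *
        ⟪x n, ∑ m, (-deriv ℓ ⟪u, x m⟫) • x m⟫) +
          β / 2 * a ^ 2 * sigmaMax x ^ 4 * deriv ℓ ⟪u, x n⟫ ^ 2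
  -- Summed over all `n`, the first-order terms give `-a ‖G‖ ^ 2`. The margin inequality makes this
  -- beat the quadratic term exactly under the step-size condition.
  have hψ : ∀ u, ∑ n, ψ n u ≤ -(a * (maxMargin x ^ 2 - a * β * sigmaMax x ^ 4 / 2)) *
      ∑ n, deriv ℓ ⟪u, x n⟫ ^ 2 := by
    intro u
    set G := ∑ m, (-deriv ℓ ⟪u, x m⟫) • x m with hG
    have h1 : ∑ n, ψ n u = -(a * ‖G‖ ^ 2) +
        β / 2 * a ^ 2 * sigmaMax x ^ 4 * ∑ n, deriv ℓ ⟪u, x n⟫ ^ 2 := by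
      simp only [ψ, Finset.sum_add_distrib, ← Finset.mul_sum]
      congr 1
      rw [← mul_neg]
      congr 1
      rw [← real_inner_self_eq_norm_sq]
      nth_rewrite 2 [hG]
      rw [sum_inner, ← Finset.sum_neg_distrib]
      refine Finset.sum_congr rfl fun n _ => ?_
      rw [inner_smul_left, conj_trivial]
      ring
    have h2 := maxMargin_sq_mul_sum_sq_le hN hx (fun n => -deriv ℓ ⟪u, x n⟫)
      fun n => (neg_pos.2 (h.deriv_neg _)).le
    simp only [neg_sq] at h2
    rw [h1]
    nlinarith [mul_le_mul_of_nonneg_left h2 ha0.le]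
  refine summable_of_descent (L := fun t => ∫ ω, trainingLoss ℓ x (w t ω) ∂P)
    (c := (B : ℝ) / N * (a * (maxMargin x ^ 2 - a * β * sigmaMax x ^ 4 / 2))) (by positivity)
    (fun t => integral_nonneg fun ω => h.trainingLoss_nonneg x _)
    (fun t => integral_nonneg fun ω => Finset.sum_nonneg fun n _ => sq_nonneg _) fun t => ?_
  calc ∫ ω, trainingLoss ℓ x (w (t + 1) ω) ∂P
      ≤ ∫ ω, (trainingLoss ℓ x (w t ω) +
          ∑ n, (if n ∈ batch t ω then 1 else 0) * ψ n (w t ω)) ∂P := by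
        refine integral_mono (hint _ _)
          ((hint _ _).add (integrable_finsetSum _ fun n _ => hint' _ _ _)) fun ω => ?_
        have := trainingLoss_minibatch_step_le h x a (batch t ω) (w t ω)
        simp only [hw, sgd_succ]
        exact this
    _ = ∫ ω, trainingLoss ℓ x (w t ω) ∂P + (B : ℝ) / N * ∫ ω, ∑ n, ψ n (w t ω) ∂P := by
        rw [integral_add (hint _ _) (integrable_finsetSum _ fun n _ => hint' _ _ _),
          integral_finsetSum _ fun n _ => hint' _ _ _, integral_finsetSum _ fun n _ => hint _ _,
          Finset.mul_sum]
        simp only [hexp]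
    _ ≤ ∫ ω, trainingLoss ℓ x (w t ω) ∂P + (B : ℝ) / N *
          ∫ ω, -(a * (maxMargin x ^ 2 - a * β * sigmaMax x ^ 4 / 2)) *
            ∑ n, deriv ℓ ⟪w t ω, x n⟫ ^ 2 ∂P := by
        refine add_le_add le_rfl (mul_le_mul_of_nonneg_left ?_ (by positivity))
        exact integral_mono (hint (fun u => ∑ n, ψ n u) t) (hint (fun u =>
          -(a * (maxMargin x ^ 2 - a * β * sigmaMax x ^ 4 / 2)) * ∑ n, deriv ℓ ⟪u, x n⟫ ^ 2) t)
          fun ω => hψ (w t ω)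
    _ = _ := by
        rw [integral_const_mul]
        ring

theorem SamplesWithReplacement.ae_exists_norm_sgd_sub_le (hN : 0 < N) (hx : LinearlySeparable x)
    (h : IsSmoothMonotoneLoss ℓ β) (htail : HasTightExponentialTail fun u => -deriv ℓ u)
    {what : Vec d} {α : Fin N → ℝ} (hα : IsStrictDual x what α) {η : ℝ} (hη : 0 < η)
    (hB : 0 < B) (hBN : B ≤ N)
    (hstep : η / B < 2 * maxMargin x ^ 2 / (β * sigmaMax x ^ 4))
    (hb : SamplesWithReplacement P B batch) (w₀ : Vec d) :
    ∀ᵐ ω ∂P, ∃ R, ∀ t : ℕ,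
      ‖sgd ℓ x η B (fun i => batch i ω) w₀ t - Real.log t • what‖ ≤ R := by
  have hN' : (0 : ℝ) < N := by exact_mod_cast hN
  have hB' : (0 : ℝ) < B := by exact_mod_cast hB
  have hEsum := hb.summable_integral_sum_deriv_sq hN hx h hη hB hstep w₀
  set w : ℕ → Ω → Vec d := fun t ω => sgd ℓ x η B (fun i => batch i ω) w₀ t with hw
  have hwf : ∀ t, (w t).FactorsThrough (past batch t) := fun t =>
    sgd_factorsThrough_past batch η B w₀ t
  have hint : ∀ (f : Vec d → ℝ) t, Integrable (fun ω => f (w t ω)) P := fun f t =>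
    hb.integrable_of_factorsThrough (t := t) fun ω ω' he => by simp only [hwf t he]
  let g : Fin N → ℕ → Ω → ℝ := fun n t ω => -deriv ℓ ⟪w t ω, x n⟫
  have hgf : ∀ n t, (g n t).FactorsThrough (past batch t) := fun n t ω ω' he => by
    simp only [g, hwf t he]
  have hle : ∀ n t ω, g n t ω ^ 2 ≤ ∑ n, deriv ℓ ⟪w t ω, x n⟫ ^ 2 := fun n t ω => by
    simp only [g, neg_sq]
    exact Finset.single_le_sum (f := fun n => deriv ℓ ⟪w t ω, x n⟫ ^ 2)
      (fun n _ => sq_nonneg _) (Finset.mem_univ n)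
  have hnoise : ∀ᵐ ω ∂P, ∀ n, ∃ C, ∀ t, |noise batch n (g n) B t ω| ≤ C := by
    refine ae_all_iff.2 fun n => hb.ae_bounded_noise hBN n (hgf n) ?_
    refine Summable.of_nonneg_of_le (fun t => integral_nonneg fun ω => sq_nonneg _)
      (fun t => ?_) hEsum
    exact integral_mono (hint (fun u => (-deriv ℓ ⟪u, x n⟫) ^ 2) t)
      (hint (fun u => ∑ n, deriv ℓ ⟪u, x n⟫ ^ 2) t) (hle n t)
  have hsummable := ae_summable_of_summable_integral
    (fun t => hint (fun u => ∑ n, deriv ℓ ⟪u, x n⟫ ^ 2) t)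
    (fun t ω => Finset.sum_nonneg fun n _ => sq_nonneg _) hEsum
  filter_upwards [hnoise, hsummable] with ω hC hS
  choose C hC using hC
  set a := η / B with ha
  have ha0 : 0 < a := by positivity
  set q := (B : ℝ) / N with hq
  have hq0 : 0 < q := by positivity
  let M : ℕ → Vec d := fun t => ∑ n, (a * noise batch n (g n) B t ω) • x n
  set R₀ := ∑ n, a * C n * ‖x n‖ with hR₀
  have hM : ∀ t, ‖M t‖ ≤ R₀ := fun t => by
    refine (norm_sum_le _ _).trans (Finset.sum_le_sum fun n _ => ?_)
    rw [norm_smul, norm_mul, Real.norm_of_nonneg ha0.le]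
    gcongr
    exact hC n t
  have hgsum : ∀ n, Summable fun t => g n t ω ^ 2 := fun n =>
    Summable.of_nonneg_of_le (fun t => sq_nonneg _) (fun t => hle n t ω) hS
  obtain ⟨U, hU⟩ := IsSmoothMonotoneLoss.exists_tail_bounds htail
  set D := ∑ n, ‖x n‖ with hD
  have hR₀0 : 0 ≤ R₀ := (norm_nonneg _).trans (hM 0)
  -- Subtracting the noise replaces each batch indicator by its mean `q`. Margins change by at most
  -- `R₀ * D`, which only affects the constants.
  have hdriven : IsExpDriven x (fun t => w t ω - M t) (fun t n => a * q * g n t ω)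
      (a * q * (1 / 2 * Real.exp (-(R₀ * D)))) (a * q * (2 * Real.exp (R₀ * D))) := by
    refine ⟨fun t => ?_, eventually_all.2 fun n => ?_, fun n => ?_⟩
    · have h1 : w (t + 1) ω = w t ω + a • ∑ n ∈ batch t ω, g n t ω • x n := sgd_succ _ _ _ _ _ _ _
      have h2 : a • ∑ n ∈ batch t ω, g n t ω • x n =
          ∑ n, (a * q * g n t ω) • x n + (M (t + 1) - M t) := by
        rw [sum_smul_eq_sum_ite_mul_smul, Finset.smul_sum, ← Finset.sum_sub_distrib,
          ← Finset.sum_add_distrib]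
        refine Finset.sum_congr rfl fun n _ => ?_
        have h3 : noise batch n (g n) B (t + 1) ω = noise batch n (g n) B t ω +
          ((if n ∈ batch t ω then 1 else 0) - q) * g n t ω := Finset.sum_range_succ _ _
        rw [h3, ← sub_smul, ← add_smul, smul_smul]
        congr 1
        ring
      rw [h1, h2]
      abel
    · have hlarge := (h.tendsto_atTop_of_summable_sq (u := fun t => ⟪w t ω, x n⟫)
        (by simpa only [g, neg_sq] using hgsum n)).eventually_gt_atTop U
      filter_upwards [hlarge] with t ht
      obtain ⟨h1, h2⟩ := hU _ ht
      have h3 : |⟪M t, x n⟫| ≤ R₀ * D :=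
        (abs_real_inner_le_norm _ _).trans (mul_le_mul (hM t)
          (Finset.single_le_sum (f := fun n => ‖x n‖) (fun _ _ => norm_nonneg _)
            (Finset.mem_univ n)) (norm_nonneg _) hR₀0)
      rw [abs_le] at h3
      rw [inner_sub_left]
      constructor
      · rw [mul_assoc (a * q), mul_assoc (1 / 2), ← Real.exp_add]
        refine mul_le_mul_of_nonneg_left (le_trans ?_ h1) (by positivity)
        gcongr
        linarith
      · rw [mul_assoc (a * q), mul_assoc 2, ← Real.exp_add]
        refine mul_le_mul_of_nonneg_left (h2.trans ?_) (by positivity)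
        gcongr
        linarith
    · simp only [mul_pow (a * q)]
      exact (hgsum n).mul_left _
  obtain ⟨R, hR⟩ := hdriven.exists_norm_sub_log_smul_le (by positivity) hα
  refine ⟨R + R₀, fun t => ?_⟩
  have h1 : w t ω - Real.log t • what = (w t ω - M t - Real.log t • what) + M t := by abel
  rw [h1]
  exact (norm_add_le _ _).trans (add_le_add (hR t) (hM t))

end WithReplacementConvergence

end SGDMaxMargin

theorem theorem2 (N d : ℕ) (hN : 0 < N) :
    ∀ᵐ x : SGDMaxMargin.Dataset N d, SGDMaxMargin.LinearlySeparable x →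
      (∃! what, SGDMaxMargin.IsHardMarginSVM x what) ∧
      ∀ what, SGDMaxMargin.IsHardMarginSVM x what →
      ∀ (ℓ : ℝ → ℝ) (β : ℝ≥0), SGDMaxMargin.IsSmoothMonotoneLoss ℓ β →
      SGDMaxMargin.HasTightExponentialTail (fun u => -deriv ℓ u) →
      ∀ (B K : ℕ), N = K * B → ∀ (η : ℝ), 0 < η → ∀ w₀ : SGDMaxMargin.Vec d,
        -- random sampling with replacement
        (η / B < 2 * SGDMaxMargin.maxMargin x ^ 2 / (β * SGDMaxMargin.sigmaMax x ^ 4) →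
          ∀ (Ω : Type*) [MeasurableSpace Ω] (P : Measure Ω) [IsProbabilityMeasure P]
            (batch : ℕ → Ω → Finset (Fin N)),
            SGDMaxMargin.SamplesWithReplacement P B batch →
            ∀ᵐ ω ∂P, SGDMaxMargin.ConvergesToSVM ℓ x what η B K
              (SGDMaxMargin.sgd ℓ x η B (fun t => batch t ω) w₀)) ∧
        -- sampling without replacement
        (η / B < min (1 / (2 * K * β * SGDMaxMargin.sigmaMax x ^ 2))
            (SGDMaxMargin.maxMargin x / (2 * β * SGDMaxMargin.sigmaMax x ^ 3 *
              (K + (SGDMaxMargin.maxMargin x)⁻¹ * SGDMaxMargin.sigmaMax x))) →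
          ∀ batch : ℕ → Finset (Fin N),
            SGDMaxMargin.SamplesWithoutReplacement B K batch →
            SGDMaxMargin.ConvergesToSVM ℓ x what η B K
              (SGDMaxMargin.sgd ℓ x η B batch w₀)) := by
  filter_upwards [SGDMaxMargin.ae_exists_isStrictDual hN] with x hgen hx
  refine ⟨SGDMaxMargin.existsUnique_isHardMarginSVM hN hx, ?_⟩
  intro what hwhat ℓ β h htail B K hNKB η hη w₀
  obtain ⟨α, hα⟩ := hgen hx what hwhat
  have hK : 0 < K := Nat.pos_of_ne_zero (by rintro rfl; simp at hNKB; omega)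
  have hB : 0 < B := Nat.pos_of_ne_zero (by rintro rfl; simp at hNKB; omega)
  constructor
  · intro hstep Ω _ P _ batch hb
    have hBN : B ≤ N := hNKB ▸ Nat.le_mul_of_pos_left B hK
    filter_upwards [hb.ae_exists_norm_sgd_sub_le hN hx h htail hα hη hB hBN hstep w₀]
      with ω ⟨R, hR⟩
    exact SGDMaxMargin.convergesToSVM_of_norm_sub_le hN h htail hwhat.1 hη hB hK hR
  · intro hstep batch hb
    obtain ⟨R, hR⟩ := SGDMaxMargin.exists_norm_sgd_sub_le_of_withoutReplacement hN hx h htail hα hη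
      hNKB hstep hb w₀
    exact SGDMaxMargin.convergesToSVM_of_norm_sub_le hN h htail hwhat.1 hη hB hK hR
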